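/- All simplicial complexes are finite geometric simplicial complexes of dimension at most $2$ in a Euclidean space $\mathbb{R}^d$, $d \ge 0$ (complexes of dimension $0$ or $1$ are allowed, and different embeddings count as different complexes). The star $\mathrm{star}(v,K)$ of a vertex $v$ of $K$ consists of all simplices of $K$ containing $v$ and all their faces. A cone is a complex $K = v * L$ for a vertex $v$ and a possibly empty complex $L$; equivalently, $K = \mathrm{star}(v,K)$ for some vertex $v$ of $K$. A planar fan is a complex in $\mathbb{R}^2$ whose underlying space is a disk, all of whose vertices lie on the boundary of the disk, and which is a cone from one of its vertices. Let $\mathcal{T}$ be a set of such complexes. It is star-closed if $\mathrm{star}(v,K) \in \mathcal{T}$ for every $K \in \mathcal{T}$ and every vertex $v$ of $K$. A simplicial-complex-supported function on $\mathcal{T}$ assigns a real number $\Lambda(K)$ to every $K \in \mathcal{T}$; a vertex-supported function assigns a real number $\phi(v,K)$ to every $K \in \mathcal{T}$ and every vertex $v$ of $K$. The function $\Lambda$ is geometrically locally determined if there is a vertex-supported function $\phi$ on $\mathcal{T}$ such that 1. (invariance under simplicial isometries of stars) if $K, L \in \mathcal{T}$ have vertices $v$ and $w$, and there is a simplicial homeomorphism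 $|\mathrm{star}(v,K)| \to |\mathrm{star}(w,L)|$ that preserves the lengths of edges and takes $v$ to $w$, then $\phi(v,K) = \phi(w,L)$; 2. (invariance under subdivision) if $K, J \in \mathcal{T}$ and $J$ is a subdivision of $K$, then $\phi(v,K) = \phi(v,J)$ for every vertex $v$ of $K$; 3. (continuity) if $K$ and $K_1, K_2, \dots$ in $\mathcal{T}$ are combinatorially equivalent complexes in the same Euclidean space, where a vertex $v$ of $K$ corresponds to the vertex $v_n$ of $K_n$, and $v_n \to v$ for every vertex $v$ of $K$, then $\phi(v_n,K_n) \to \phi(v,K)$ for every vertex $v$ of $K$; 4. (Descartes-Gauss-Bonnet) $\sum_{v} \phi(v,K) = \Lambda(K)$ for every $K \in \mathcal{T}$, the sum being over all vertices of $K$. **Corollary.** Let $\mathcal{T}$ be a star-closed set of such complexes that contains all planar fans. Then the Euler characteristic $\chi(K) = f_0(K) - f_1(K) + f_2(K)$, where $f_i(K)$ is the number of $i$-simplices of $K$, is the unique simplicial-complex-supported function on $\mathcal{T}$ that is geometrically locally determined and has value $1$ on all cones in $\mathcal{T}$. -/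

import Mathlib

noncomputable section

/-- A finite geometric simplicial complex of dimension at most `2` in Euclidean space `ℝ^d`.
Simplices are recorded by their (nonempty, affinely independent) finite vertex sets. Complexes of
dimension `0` and `1` are included: a single edge and a single vertex are complexes here. -/
structure TwoComplex (d : ℕ) extends
    Geometry.SimplicialComplex ℝ (EuclideanSpace ℝ (Fin d)) where
  finite_faces : faces.Finite
  card_le_three : ∀ s ∈ faces, s.card ≤ 3

namespace TwoComplex

variable {d e : ℕ}

theorem finite_vertices (K : TwoComplex d) : K.vertices.Finite :=
  K.finite_faces.preimage (f := fun x => ({x} : Finset (EuclideanSpace ℝ (Fin d))))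
    Finset.singleton_injective.injOn

instance (K : TwoComplex d) : Fintype K.vertices := K.finite_vertices.fintype

/-- The number `f_i(K)` of `i`-simplices of `K`. -/
def numSimplices (K : TwoComplex d) (i : ℕ) : ℕ :=
  {s ∈ K.faces | s.card = i + 1}.ncard

/-- The Euler characteristic `f_0 - f_1 + f_2`. -/
def eulerChar (K : TwoComplex d) : ℤ :=
  (K.numSimplices 0 : ℤ) - K.numSimplices 1 + K.numSimplices 2

/-- The (closed) star of `v` in `K`: all simplices of `K` containing `v`, and all their faces. -/
def star (K : TwoComplex d) (v : EuclideanSpace ℝ (Fin d)) : TwoComplex d where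
  faces := {s | s.Nonempty ∧ ∃ t ∈ K.faces, v ∈ t ∧ s ⊆ t}
  isRelLowerSet_faces := by
    rintro s ⟨hs, t, ht, hv, hst⟩
    exact ⟨hs, fun u hu hne => ⟨hne, t, ht, hv, hu.trans hst⟩⟩
  indep := by
    rintro s ⟨hs, t, ht, hv, hst⟩
    exact K.indep (K.down_closed ht hst hs)
  inter_subset_convexHull := by
    rintro s s' ⟨hs, t, ht, hv, hst⟩ ⟨hs', t', ht', hv', hst'⟩
    exact K.inter_subset_convexHull (K.down_closed ht hst hs) (K.down_closed ht' hst' hs')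
  finite_faces := K.finite_faces.subset fun s ⟨hs, t, ht, _, hst⟩ => K.down_closed ht hst hs
  card_le_three := fun s ⟨hs, t, ht, _, hst⟩ => K.card_le_three s (K.down_closed ht hst hs)

theorem mem_vertices_star (K : TwoComplex d) {v : EuclideanSpace ℝ (Fin d)}
    (hv : v ∈ K.vertices) : v ∈ (K.star v).vertices :=
  ⟨Finset.singleton_nonempty v, {v}, hv, Finset.mem_singleton_self v, subset_rfl⟩

/-- `K` is a cone with apex `v`, that is `K = v * L` for some (possibly empty) complex `L`:
`v` is a vertex of `K`, and each simplex of `K` is a face of a simplex of `K` containing `v`. -/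
def IsConeFrom (K : TwoComplex d) (v : EuclideanSpace ℝ (Fin d)) : Prop :=
  v ∈ K.vertices ∧ ∀ s ∈ K.faces, ∃ t ∈ K.faces, v ∈ t ∧ s ⊆ t

def IsCone (K : TwoComplex d) : Prop := ∃ v, K.IsConeFrom v

/-- A planar fan: a complex in `ℝ²` whose underlying space is a disk, all of whose vertices lie on
the boundary circle of the disk, and which is a cone from one of its vertices. -/
def IsPlanarFan (K : TwoComplex 2) : Prop :=
  (∃ h : K.space ≃ₜ Metric.closedBall (0 : EuclideanSpace ℝ (Fin 2)) 1,
    ∀ x : K.space, (x : EuclideanSpace ℝ (Fin 2)) ∈ K.vertices →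
      (h x : EuclideanSpace ℝ (Fin 2)) ∈ Metric.sphere (0 : EuclideanSpace ℝ (Fin 2)) 1) ∧
  K.IsCone

/-- `J` is a subdivision of `K`: both have the same underlying space, and each simplex of `J` is
contained in a simplex of `K`. -/
def IsSubdivision (J K : TwoComplex d) : Prop :=
  J.space = K.space ∧ ∀ s ∈ J.faces, ∃ t ∈ K.faces,
    convexHull ℝ (s : Set (EuclideanSpace ℝ (Fin d))) ⊆ convexHull ℝ (t : Set _)

theorem mem_extremePoints_of_affineIndependent {t : Finset (EuclideanSpace ℝ (Fin d))}
    (ht : AffineIndependent ℝ ((↑) : t → EuclideanSpace ℝ (Fin d)))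
    {v : EuclideanSpace ℝ (Fin d)} (hv : v ∈ t) :
    v ∈ (convexHull ℝ (t : Set (EuclideanSpace ℝ (Fin d)))).extremePoints ℝ := by
  obtain ⟨u, htu, hu, htop⟩ := exists_subset_affineIndependent_affineSpan_eq_top
    (s := (t : Set (EuclideanSpace ℝ (Fin d)))) ht
  have : Finite u := finite_set_of_fin_dim_affineIndependent ℝ hu
  let b : AffineBasis u ℝ (EuclideanSpace ℝ (Fin d)) := ⟨Subtype.val, hu, by simpa using htop⟩
  have hb : ∀ (i : u) (p : EuclideanSpace ℝ (Fin d)), p ∈ t →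
      b.coord i p = 0 ∨ b.coord i p = 1 := by
    intro i p hp
    have := b.coord_apply i ⟨p, htu hp⟩
    change b.coord i p = _ at this
    rw [this]
    split_ifs <;> simp
  have hI : ∀ (i : u) (x : EuclideanSpace ℝ (Fin d)),
      x ∈ convexHull ℝ (t : Set (EuclideanSpace ℝ (Fin d))) → b.coord i x ∈ Set.Icc (0 : ℝ) 1 := by
    intro i x hx
    have hsub : (t : Set (EuclideanSpace ℝ (Fin d))) ⊆ (b.coord i) ⁻¹' Set.Icc (0 : ℝ) 1 := by
      intro p hp
      rcases hb i p hp with h | h <;> simp [h]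
    exact convexHull_min hsub ((convex_Icc (0 : ℝ) 1).affine_preimage (b.coord i)) hx
  refine mem_extremePoints.2 ⟨subset_convexHull ℝ _ hv, ?_⟩
  rintro x hx y hy ⟨a, c, ha, hc, hac, hxy⟩
  have key : ∀ i : u, b.coord i x = b.coord i v ∧ b.coord i y = b.coord i v := by
    intro i
    have h1 : b.coord i v = a * b.coord i x + c * b.coord i y := by
      rw [← hxy, Convex.combo_affine_apply hac]
      simp
    obtain ⟨hx0, hx1⟩ := hI i x hx
    obtain ⟨hy0, hy1⟩ := hI i y hy
    rcases hb i v hv with h | h <;> rw [h] at h1 ⊢ <;> constructor <;> nlinarith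
  exact ⟨b.ext_elem fun i => (key i).1, b.ext_elem fun i => (key i).2⟩

theorem IsSubdivision.vertices_subset {J K : TwoComplex d} (h : J.IsSubdivision K) :
    K.vertices ⊆ J.vertices := by
  intro v hv
  have hvJ : v ∈ J.space := h.1 ▸ K.vertices_subset_space hv
  obtain ⟨s, hs, hvs⟩ := Geometry.SimplicialComplex.mem_space_iff.1 hvJ
  obtain ⟨t, ht, hst⟩ := h.2 s hs
  have hvt : v ∈ t := (Geometry.SimplicialComplex.vertex_mem_convexHull_iff hv ht).1 (hst hvs)
  have hext : v ∈ (convexHull ℝ (t : Set (EuclideanSpace ℝ (Fin d)))).extremePoints ℝ :=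
    mem_extremePoints_of_affineIndependent (K.indep ht) hvt
  have : v ∈ (s : Set (EuclideanSpace ℝ (Fin d))) :=
    extremePoints_convexHull_subset (inter_extremePoints_subset_extremePoints_of_subset hst
      ⟨hvs, hext⟩)
  exact J.down_closed hs (Finset.singleton_subset_iff.2 this) (Finset.singleton_nonempty v)

/-- A combinatorial equivalence (simplicial isomorphism) of `K` and `L`: a bijection of the vertex
sets under which a set of vertices spans a simplex of `K` iff its image spans a simplex of `L`.
Its extension that is affine on each simplex is a simplicial homeomorphism `|K| → |L|`, and every
simplicial homeomorphism arises in this way from a unique such bijection. -/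
structure CombEquiv (K : TwoComplex d) (L : TwoComplex e) where
  toEquiv : K.vertices ≃ L.vertices
  mem_faces_iff : ∀ s : Finset K.vertices,
    s.map (.subtype _) ∈ K.faces ↔ (s.map toEquiv.toEmbedding).map (.subtype _) ∈ L.faces

/-- The simplicial homeomorphism given by `f` preserves the lengths of edges, that is, the
distance of any two vertices of `K` that lie in a common simplex. -/
def CombEquiv.IsIsometry {K : TwoComplex d} {L : TwoComplex e} (f : K.CombEquiv L) : Prop :=
  ∀ x y : K.vertices, (∃ s ∈ K.faces, (x : EuclideanSpace ℝ (Fin d)) ∈ s ∧ y.1 ∈ s) →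
    dist (f.toEquiv x : EuclideanSpace ℝ (Fin e)) (f.toEquiv y) =
      dist (x : EuclideanSpace ℝ (Fin d)) y

/-- The stars of `v` in `K` and of `w` in `L` are simplicially isometric, by a simplicial isometry
that takes `v` to `w`. -/
def StarsIsometric (K : TwoComplex d) (v : K.vertices) (L : TwoComplex e) (w : L.vertices) :
    Prop :=
  ∃ f : (K.star v).CombEquiv (L.star w), f.IsIsometry ∧
    (f.toEquiv ⟨v, K.mem_vertices_star v.2⟩ : EuclideanSpace ℝ (Fin e)) = w

end TwoComplex

/-- A finite simplicial complex of dimension at most `2` in some Euclidean space `ℝ^d`. -/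
abbrev EuclideanTwoComplex : Type := Σ d : ℕ, TwoComplex d

/-- Simplicial-complex-supported functions on `T`. -/
abbrev ComplexFunction (T : Set EuclideanTwoComplex) : Type := T → ℝ

/-- Vertex-supported functions on `T`. -/
abbrev VertexFunction (T : Set EuclideanTwoComplex) : Type :=
  (K : T) → K.1.2.vertices → ℝ

def StarClosed (T : Set EuclideanTwoComplex) : Prop :=
  ∀ K ∈ T, ∀ v ∈ K.2.vertices, (⟨K.1, K.2.star v⟩ : EuclideanTwoComplex) ∈ T

namespace VertexFunction

variable {T : Set EuclideanTwoComplex}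

def InvariantUnderStarIsometry (φ : VertexFunction T) : Prop :=
  ∀ (K L : T) (v : K.1.2.vertices) (w : L.1.2.vertices),
    K.1.2.StarsIsometric v L.1.2 w → φ K v = φ L w

def InvariantUnderSubdivision (φ : VertexFunction T) : Prop :=
  ∀ (d : ℕ) (K J : TwoComplex d) (hK : ⟨d, K⟩ ∈ T) (hJ : ⟨d, J⟩ ∈ T) (h : J.IsSubdivision K)
    (v : K.vertices), φ ⟨⟨d, K⟩, hK⟩ v = φ ⟨⟨d, J⟩, hJ⟩ ⟨v, h.vertices_subset v.2⟩

/-- Continuity: if complexes `J n` in the same Euclidean space as `K` converge to `K`, as embeddings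
of one abstract simplicial complex (the identifications being `f n`), then the values of `φ` at
corresponding vertices converge. -/
def IsContinuous (φ : VertexFunction T) : Prop :=
  ∀ (d : ℕ) (K : TwoComplex d) (J : ℕ → TwoComplex d) (hK : ⟨d, K⟩ ∈ T) (hJ : ∀ n, ⟨d, J n⟩ ∈ T)
    (f : ∀ n, K.CombEquiv (J n)),
    (∀ v : K.vertices, Filter.Tendsto
      (fun n => ((f n).toEquiv v : EuclideanSpace ℝ (Fin d))) Filter.atTop (nhds v)) →
    ∀ v : K.vertices, Filter.Tendsto
      (fun n => φ ⟨⟨d, J n⟩, hJ n⟩ ((f n).toEquiv v)) Filter.atTop (nhds (φ ⟨⟨d, K⟩, hK⟩ v))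

/-- `φ` satisfies the Descartes-Gauss-Bonnet Theorem with respect to `Λ`. -/
def SatisfiesDGB (φ : VertexFunction T) (Λ : ComplexFunction T) : Prop :=
  ∀ K : T, ∑ v : K.1.2.vertices, φ K v = Λ K

end VertexFunction

def GeometricallyLocallyDetermined {T : Set EuclideanTwoComplex} (Λ : ComplexFunction T) : Prop :=
  ∃ φ : VertexFunction T, VertexFunction.InvariantUnderStarIsometry φ ∧
    VertexFunction.InvariantUnderSubdivision φ ∧ VertexFunction.IsContinuous φ ∧
    VertexFunction.SatisfiesDGB φ Λ

/-- The Euler characteristic as a simplicial-complex-supported function on `T`. -/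
def eulerFunction (T : Set EuclideanTwoComplex) : ComplexFunction T :=
  fun K => (K.1.2.eulerChar : ℝ)

end

/-! Existence. Give a simplex `s` and a vertex `v` of it the weight `1` for a point, `-1/2` for an
edge and `1/2 - angle/(2π)` for a triangle. Since the angles of a triangle sum to `π`, these weights
add up to `(-1)^dim s` over the vertices of `s` (`sum_exteriorAngle`). The curvature at `v` is the
sum of the weights over the simplices containing `v`, so its total is the Euler characteristic
(`sum_curvature`). It depends only on edge lengths in the star and varies continuously with the
vertices. Invariance under subdivision (`IsSubdivision.curvature_eq`) is the substantial point:
around a vertex `v` of a triangle, `n` edges of the subdivision bound `n - 1` triangles whose angles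
add up to the old one (`IsSubdivision.fan`), so the contribution `1 - n/2 + (n-1)/2 - angle/(2π)` is
independent of `n`.

Uniqueness (`VertexFunction.eq_eulerFunction`). The star of a simplex `s` is a cone, so `Λ` is `1`
on it. By Descartes-Gauss-Bonnet this `1` splits over the vertices in `s` and those in its link, and
the value at a link vertex `x` equals its value in the star of `s ∪ {x}`. If `G i` is the sum, over
`i`-simplices `t` and vertices `x` of `t`, of the value at `x` in the star of `t`, then `f_i = G i +
G (i+1)`. As `Λ(K) = G 0` and `G 3 = 0`, the alternating sum telescopes to `Λ(K) = f_0 - f_1 + f_2`.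
-/

noncomputable section

open scoped Classical

namespace TwoComplex

variable {d e : ℕ}

/-! ### Finite sums over simplices, and the Euler characteristic of cones. -/

/-- The simplices of `K` as a finite set. -/
def facesFinset (K : TwoComplex d) : Finset (Finset (EuclideanSpace ℝ (Fin d))) :=
  K.finite_faces.toFinset

@[simp]
theorem mem_facesFinset {K : TwoComplex d} {s : Finset (EuclideanSpace ℝ (Fin d))} :
    s ∈ K.facesFinset ↔ s ∈ K.faces :=
  K.finite_faces.mem_toFinset

/-- The vertices of `K` as a finite set. -/
def verticesFinset (K : TwoComplex d) : Finset (EuclideanSpace ℝ (Fin d)) :=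
  K.finite_vertices.toFinset

@[simp]
theorem mem_verticesFinset {K : TwoComplex d} {v : EuclideanSpace ℝ (Fin d)} :
    v ∈ K.verticesFinset ↔ v ∈ K.vertices :=
  K.finite_vertices.mem_toFinset

theorem sum_vertices (K : TwoComplex d) (f : EuclideanSpace ℝ (Fin d) → ℝ) :
    ∑ v : K.vertices, f v = ∑ v ∈ K.verticesFinset, f v :=
  (Finset.sum_subtype _ (fun _ => mem_verticesFinset) f).symm

theorem mem_vertices_of_mem {K : TwoComplex d} {s : Finset (EuclideanSpace ℝ (Fin d))}
    (hs : s ∈ K.faces) {v : EuclideanSpace ℝ (Fin d)} (hv : v ∈ s) : v ∈ K.vertices :=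
  K.down_closed hs (Finset.singleton_subset_iff.2 hv) (Finset.singleton_nonempty v)

theorem card_pos_of_mem {K : TwoComplex d} {s : Finset (EuclideanSpace ℝ (Fin d))}
    (hs : s ∈ K.faces) : 0 < s.card :=
  (K.nonempty_of_mem_faces hs).card_pos

theorem card_eq_one_or_two_or_three {K : TwoComplex d} {s : Finset (EuclideanSpace ℝ (Fin d))}
    (hs : s ∈ K.faces) : s.card = 1 ∨ s.card = 2 ∨ s.card = 3 := by
  have := card_pos_of_mem hs
  have := K.card_le_three s hs
  omega

theorem ext_faces {K L : TwoComplex d} (h : ∀ s, s ∈ K.faces ↔ s ∈ L.faces) : K = L := by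
  obtain ⟨K, _, _⟩ := K
  obtain ⟨L, _, _⟩ := L
  have : K = L := Geometry.SimplicialComplex.ext (Set.ext h)
  subst this
  rfl

theorem numSimplices_eq (K : TwoComplex d) (i : ℕ) :
    K.numSimplices i = (K.facesFinset.filter (fun s => s.card = i + 1)).card := by
  rw [numSimplices, ← Set.ncard_coe_finset]
  congr 1
  ext s
  simp

theorem eulerChar_eq_sum (K : TwoComplex d) :
    (K.eulerChar : ℝ) = ∑ s ∈ K.facesFinset, (-1 : ℝ) ^ (s.card + 1) := by
  have h : ∀ s ∈ K.facesFinset, (-1 : ℝ) ^ (s.card + 1) =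
      (if s.card = 0 + 1 then 1 else 0) - (if s.card = 1 + 1 then 1 else 0) +
        (if s.card = 2 + 1 then 1 else 0) := by
    intro s hs
    rcases card_eq_one_or_two_or_three (mem_facesFinset.1 hs) with h | h | h <;> rw [h] <;> norm_num
  rw [Finset.sum_congr rfl h, Finset.sum_add_distrib, Finset.sum_sub_distrib, Finset.sum_boole,
    Finset.sum_boole, Finset.sum_boole, eulerChar, numSimplices_eq, numSimplices_eq,
    numSimplices_eq]
  push_cast
  rfl

/-- Adding or removing the apex `v` pairs off the simplices other than `{v}` with opposite signs.
Only `{v}` survives, because its partner would be the empty set. -/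
theorem IsCone.eulerChar_eq_one {K : TwoComplex d} (hK : K.IsCone) : (K.eulerChar : ℝ) = 1 := by
  obtain ⟨v, hv, hcone⟩ := hK
  rw [eulerChar_eq_sum, ← Finset.add_sum_erase _ _ (mem_facesFinset.2 hv)]
  have : ∑ s ∈ K.facesFinset.erase {v}, (-1 : ℝ) ^ (s.card + 1) = 0 := by
    refine Finset.sum_involution (fun s _ => if v ∈ s then s.erase v else insert v s) ?_ ?_ ?_ ?_
    · intro s hs
      split_ifs with h
      · rw [← Finset.card_erase_add_one h]
        ring
      · rw [Finset.card_insert_of_notMem h]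
        ring
    · intro s hs _
      split_ifs with h
      · exact fun hh => Finset.notMem_erase v s ((Finset.ext_iff.1 hh v).2 h)
      · exact fun hh => h (hh ▸ Finset.mem_insert_self v s)
    · intro s hs
      rw [Finset.mem_erase, mem_facesFinset] at hs
      split_ifs with h
      · rw [Finset.mem_erase, mem_facesFinset]
        refine ⟨fun hh => Finset.notMem_erase v s (by rw [hh]; simp), ?_⟩
        refine K.down_closed hs.2 (Finset.erase_subset _ _) ?_
        rw [Finset.nonempty_iff_ne_empty, Ne, Finset.erase_eq_empty_iff]
        rintro (h0 | h0)
        · simp [h0] at h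
        · exact hs.1 h0
      · rw [Finset.mem_erase, mem_facesFinset]
        obtain ⟨t, ht, hvt, hst⟩ := hcone s hs.2
        refine ⟨fun hh => ?_, K.down_closed ht (Finset.insert_subset hvt hst)
          (Finset.insert_nonempty _ _)⟩
        obtain ⟨x, hx⟩ := K.nonempty_of_mem_faces hs.2
        have : x ∈ ({v} : Finset (EuclideanSpace ℝ (Fin d))) := hh ▸ Finset.mem_insert_of_mem hx
        rw [Finset.mem_singleton] at this
        exact h (this ▸ hx)
    · intro s hs
      by_cases h : v ∈ s
      · simp [h, Finset.insert_erase h]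
      · simp [h, Finset.erase_insert h]
  rw [this]
  norm_num

/-! ### The curvature -/

/-- The angle at `v` of the simplex with vertex set `s`; it is zero in dimensions `0` and `1`. -/
def angleAt (v : EuclideanSpace ℝ (Fin d)) (s : Finset (EuclideanSpace ℝ (Fin d))) : ℝ :=
  -- Summing over ordered pairs avoids ordering the other two vertices; diagonal terms are zero and
  -- the angle is counted twice, hence the halving.
  (∑ x ∈ s.erase v, ∑ y ∈ s.erase v, EuclideanGeometry.angle x v y) / 2

/-- The signed exterior angle at `v` of the simplex with vertex set `s`, normalised so that these
sum to `(-1) ^ dim s` over the vertices of `s`. -/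
def exteriorAngle (v : EuclideanSpace ℝ (Fin d)) (s : Finset (EuclideanSpace ℝ (Fin d))) : ℝ :=
  (if s.card = 1 then 1 else if s.card = 2 then -1 / 2 else 1 / 2) - angleAt v s / (2 * Real.pi)

/-- The curvature of `K` at `v`. -/
def curvature (K : TwoComplex d) (v : EuclideanSpace ℝ (Fin d)) : ℝ :=
  ∑ s ∈ K.facesFinset.filter (fun s => v ∈ s), exteriorAngle v s

theorem angleAt_singleton (v : EuclideanSpace ℝ (Fin d)) : angleAt v {v} = 0 := by
  simp [angleAt]

theorem angleAt_pair {v x : EuclideanSpace ℝ (Fin d)} (h : x ≠ v) : angleAt v {v, x} = 0 := by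
  simp [angleAt, Finset.erase_insert_eq_erase, h.symm, EuclideanGeometry.angle_self_of_ne h]

theorem angleAt_triple {v x y : EuclideanSpace ℝ (Fin d)} (hx : x ≠ v) (hy : y ≠ v) (hxy : x ≠ y) :
    angleAt v {v, x, y} = EuclideanGeometry.angle x v y := by
  have : ({v, x, y} : Finset (EuclideanSpace ℝ (Fin d))).erase v = {x, y} := by
    rw [Finset.erase_insert]
    simp [hx.symm, hy.symm]
  rw [angleAt, this, Finset.sum_pair hxy, Finset.sum_pair hxy, Finset.sum_pair hxy,
    EuclideanGeometry.angle_self_of_ne hx, EuclideanGeometry.angle_self_of_ne hy,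
    EuclideanGeometry.angle_comm y v x]
  ring

theorem exteriorAngle_singleton (v : EuclideanSpace ℝ (Fin d)) : exteriorAngle v {v} = 1 := by
  simp [exteriorAngle, angleAt_singleton]

theorem exteriorAngle_pair {v x : EuclideanSpace ℝ (Fin d)} (h : x ≠ v) :
    exteriorAngle v {v, x} = -1 / 2 := by
  simp [exteriorAngle, angleAt_pair h, Finset.card_pair h.symm]

theorem exteriorAngle_triple {v x y : EuclideanSpace ℝ (Fin d)} (hx : x ≠ v) (hy : y ≠ v)
    (hxy : x ≠ y) :
    exteriorAngle v {v, x, y} = 1 / 2 - EuclideanGeometry.angle x v y / (2 * Real.pi) := by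
  simp [exteriorAngle, angleAt_triple hx hy hxy,
    Finset.card_eq_three.2 ⟨v, x, y, hx.symm, hy.symm, hxy, rfl⟩]

/-- In the triangle case this is the angle sum: `3/2 - π/(2π) = 1`. -/
theorem sum_exteriorAngle {K : TwoComplex d} {s : Finset (EuclideanSpace ℝ (Fin d))}
    (hs : s ∈ K.faces) : ∑ v ∈ s, exteriorAngle v s = (-1) ^ (s.card + 1) := by
  rcases card_eq_one_or_two_or_three hs with h | h | h
  · obtain ⟨v, rfl⟩ := Finset.card_eq_one.1 h
    simp [exteriorAngle_singleton]
  · obtain ⟨v, x, hvx, rfl⟩ := Finset.card_eq_two.1 h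
    rw [h, Finset.sum_pair hvx, exteriorAngle_pair hvx.symm, Finset.pair_comm,
      exteriorAngle_pair hvx]
    norm_num
  · obtain ⟨v, x, y, hvx, hvy, hxy, rfl⟩ := Finset.card_eq_three.1 h
    have h1 : ({v, x, y} : Finset (EuclideanSpace ℝ (Fin d))) = {x, y, v} := by grind
    have h2 : ({v, x, y} : Finset (EuclideanSpace ℝ (Fin d))) = {y, v, x} := by grind
    rw [h, Finset.sum_insert (by simp [hvx, hvy]), Finset.sum_pair hxy,
      exteriorAngle_triple hvx.symm hvy.symm hxy]
    rw [h1, exteriorAngle_triple hxy.symm hvx hvy.symm, ← h1, h2,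
      exteriorAngle_triple hvy hxy hvx]
    have := EuclideanGeometry.angle_add_angle_add_angle_eq_pi y hvx.symm
    rw [EuclideanGeometry.angle_comm y v x, EuclideanGeometry.angle_comm v x y,
      EuclideanGeometry.angle_comm x y v] at this
    have hpi := Real.pi_ne_zero
    field_simp
    norm_num
    linarith

theorem sum_curvature (K : TwoComplex d) : ∑ v : K.vertices, K.curvature v = K.eulerChar := by
  rw [sum_vertices, eulerChar_eq_sum]
  simp only [curvature]
  rw [Finset.sum_comm' (t' := K.facesFinset) (s' := fun s => s)]
  · exact Finset.sum_congr rfl fun s hs => sum_exteriorAngle (mem_facesFinset.1 hs)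
  · intro v s
    simp only [mem_verticesFinset, Finset.mem_filter, mem_facesFinset]
    exact ⟨fun h => ⟨h.2.2, h.2.1⟩, fun h => ⟨mem_vertices_of_mem h.2 h.1, h.2, h.1⟩⟩

/-! ### Behaviour under combinatorial equivalences -/

namespace CombEquiv

variable {K : TwoComplex d} {L : TwoComplex e}

/-- The vertex map of a combinatorial equivalence, extended by `0`. -/
def vertexMap (f : K.CombEquiv L) (x : EuclideanSpace ℝ (Fin d)) : EuclideanSpace ℝ (Fin e) :=
  if h : x ∈ K.vertices then f.toEquiv ⟨x, h⟩ else 0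

theorem vertexMap_apply (f : K.CombEquiv L) (x : K.vertices) : f.vertexMap x = f.toEquiv x := by
  simp [vertexMap]

theorem vertexMap_injOn (f : K.CombEquiv L) : Set.InjOn f.vertexMap K.vertices := by
  intro x hx y hy h
  have := f.vertexMap_apply ⟨x, hx⟩
  have := f.vertexMap_apply ⟨y, hy⟩
  have : f.toEquiv ⟨x, hx⟩ = f.toEquiv ⟨y, hy⟩ := Subtype.ext (by simp_all)
  simpa using this

theorem vertexMap_injOn_face (f : K.CombEquiv L) {s : Finset (EuclideanSpace ℝ (Fin d))}
    (hs : s ∈ K.faces) : Set.InjOn f.vertexMap s :=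
  f.vertexMap_injOn.mono fun _ hx => mem_vertices_of_mem hs hx

theorem image_map_subtype (f : K.CombEquiv L) (s : Finset K.vertices) :
    (s.map (.subtype _)).image f.vertexMap = (s.map f.toEquiv.toEmbedding).map (.subtype _) := by
  ext x
  simp only [Finset.mem_image, Finset.mem_map, Function.Embedding.coe_subtype]
  constructor
  · rintro ⟨_, ⟨y, hy, rfl⟩, rfl⟩
    exact ⟨f.toEquiv y, ⟨y, hy, rfl⟩, (f.vertexMap_apply y).symm⟩
  · rintro ⟨_, ⟨y, hy, rfl⟩, rfl⟩
    exact ⟨y, ⟨y, hy, rfl⟩, f.vertexMap_apply y⟩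

theorem exists_eq_map_subtype {s : Finset (EuclideanSpace ℝ (Fin d))} (hs : s ∈ K.faces) :
    ∃ s' : Finset K.vertices, s = s'.map (.subtype _) := by
  refine ⟨s.subtype (· ∈ K.vertices), ?_⟩
  rw [Finset.subtype_map, Finset.filter_true_of_mem]
  exact fun x hx => mem_vertices_of_mem hs hx

theorem image_mem_faces (f : K.CombEquiv L) {s : Finset (EuclideanSpace ℝ (Fin d))}
    (hs : s ∈ K.faces) : s.image f.vertexMap ∈ L.faces := by
  obtain ⟨s', rfl⟩ := exists_eq_map_subtype hs
  rw [image_map_subtype]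
  exact (f.mem_faces_iff s').1 hs

theorem exists_image_eq (f : K.CombEquiv L) {t : Finset (EuclideanSpace ℝ (Fin e))}
    (ht : t ∈ L.faces) : ∃ s ∈ K.faces, s.image f.vertexMap = t := by
  obtain ⟨t', rfl⟩ := exists_eq_map_subtype ht
  have h : (t'.map f.toEquiv.symm.toEmbedding).map f.toEquiv.toEmbedding = t' := by
    ext; simp
  refine ⟨(t'.map f.toEquiv.symm.toEmbedding).map (.subtype _), ?_, ?_⟩
  · rw [f.mem_faces_iff, h]
    exact ht
  · rw [image_map_subtype, h]

/-- Rewriting the curvature of `L` over the simplices of `K` gives a fixed index set, on which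
isometric stars or a convergent sequence can be compared term by term. -/
theorem curvature_eq (f : K.CombEquiv L) (v : K.vertices) :
    L.curvature (f.toEquiv v) = ∑ s ∈ K.facesFinset.filter (fun s => (v : EuclideanSpace ℝ _) ∈ s),
      exteriorAngle (f.vertexMap v) (s.image f.vertexMap) := by
  rw [curvature, ← vertexMap_apply]
  symm
  refine Finset.sum_bij (fun s _ => s.image f.vertexMap) ?_ ?_ ?_ ?_
  · intro s hs
    rw [Finset.mem_filter, mem_facesFinset] at hs ⊢
    exact ⟨f.image_mem_faces hs.1, Finset.mem_image_of_mem _ hs.2⟩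
  · intro s hs t ht h
    rw [Finset.mem_filter, mem_facesFinset] at hs ht
    have h' : f.vertexMap '' s = f.vertexMap '' t := by
      rw [← Finset.coe_image, ← Finset.coe_image, h]
    exact_mod_cast (f.vertexMap_injOn.image_eq_image_iff (fun x hx => mem_vertices_of_mem hs.1 hx)
      (fun x hx => mem_vertices_of_mem ht.1 hx)).1 h'
  · intro t ht
    rw [Finset.mem_filter, mem_facesFinset] at ht
    obtain ⟨s, hs, rfl⟩ := f.exists_image_eq ht.1
    refine ⟨s, ?_, rfl⟩
    rw [Finset.mem_filter, mem_facesFinset]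
    obtain ⟨x, hx, hxv⟩ := Finset.mem_image.1 ht.2
    exact ⟨hs, f.vertexMap_injOn (mem_vertices_of_mem hs hx) v.2 hxv ▸ hx⟩
  · intro _ _
    rfl

theorem exteriorAngle_image (f : K.CombEquiv L) {s : Finset (EuclideanSpace ℝ (Fin d))}
    (hs : s ∈ K.faces) {v : EuclideanSpace ℝ (Fin d)} (hv : v ∈ s) :
    exteriorAngle (f.vertexMap v) (s.image f.vertexMap) =
      (if s.card = 1 then 1 else if s.card = 2 then -1 / 2 else 1 / 2) -
        (∑ x ∈ s.erase v, ∑ y ∈ s.erase v,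
          EuclideanGeometry.angle (f.vertexMap x) (f.vertexMap v) (f.vertexMap y)) / 2 /
          (2 * Real.pi) := by
  have hinj := f.vertexMap_injOn_face hs
  have herase : (s.image f.vertexMap).erase (f.vertexMap v) = (s.erase v).image f.vertexMap := by
    ext y
    simp only [Finset.mem_erase, Finset.mem_image]
    constructor
    · rintro ⟨hy, x, hx, rfl⟩
      exact ⟨x, ⟨fun h => hy (h ▸ rfl), hx⟩, rfl⟩
    · rintro ⟨x, ⟨hxv, hx⟩, rfl⟩
      exact ⟨fun h => hxv (hinj hx hv h), x, hx, rfl⟩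
  have hinj' : Set.InjOn f.vertexMap (s.erase v : Finset _) :=
    hinj.mono (by simp)
  rw [exteriorAngle, angleAt, herase, Finset.card_image_of_injOn hinj, Finset.sum_image hinj']
  simp_rw [Finset.sum_image hinj']

end CombEquiv

theorem mem_star_faces_iff {K : TwoComplex d} {v : EuclideanSpace ℝ (Fin d)}
    {s : Finset (EuclideanSpace ℝ (Fin d))} :
    s ∈ (K.star v).faces ↔ s.Nonempty ∧ ∃ t ∈ K.faces, v ∈ t ∧ s ⊆ t := Iff.rfl

theorem curvature_star (K : TwoComplex d) (v : EuclideanSpace ℝ (Fin d)) :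
    (K.star v).curvature v = K.curvature v := by
  rw [curvature, curvature]
  congr 1
  ext s
  simp only [Finset.mem_filter, mem_facesFinset, mem_star_faces_iff]
  constructor
  · rintro ⟨⟨hs, t, ht, _, hst⟩, hv⟩
    exact ⟨K.down_closed ht hst hs, hv⟩
  · rintro ⟨hs, hv⟩
    exact ⟨⟨⟨v, hv⟩, s, hs, hv, subset_rfl⟩, hv⟩

/-- Law of cosines: the inner product is a function of the three side lengths. -/
theorem angle_eq_of_dist_eq {x v y : EuclideanSpace ℝ (Fin d)} {x' v' y' : EuclideanSpace ℝ (Fin e)}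
    (h1 : dist x' v' = dist x v) (h2 : dist y' v' = dist y v) (h3 : dist x' y' = dist x y) :
    EuclideanGeometry.angle x' v' y' = EuclideanGeometry.angle x v y := by
  rw [dist_eq_norm, dist_eq_norm] at h1 h2 h3
  have h3' : ‖(x' - v') - (y' - v')‖ = ‖(x - v) - (y - v)‖ := by simpa using h3
  simp only [EuclideanGeometry.angle, InnerProductGeometry.angle, vsub_eq_sub]
  rw [real_inner_eq_norm_mul_self_add_norm_mul_self_sub_norm_sub_mul_self_div_two,
    real_inner_eq_norm_mul_self_add_norm_mul_self_sub_norm_sub_mul_self_div_two, h1, h2, h3']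

theorem StarsIsometric.curvature_eq {K : TwoComplex d} {v : K.vertices} {L : TwoComplex e}
    {w : L.vertices} (h : StarsIsometric K v L w) : K.curvature v = L.curvature w := by
  obtain ⟨f, hf, hfv⟩ := h
  have hfL : (L.star w).curvature w =
      (L.star w).curvature (f.toEquiv ⟨v, K.mem_vertices_star v.2⟩) := by
    rw [hfv]
  rw [← curvature_star K, ← curvature_star L, hfL, f.curvature_eq, curvature]
  refine Finset.sum_congr rfl fun s hs => ?_
  rw [Finset.mem_filter, mem_facesFinset] at hs
  have hdist : ∀ x ∈ s, ∀ y ∈ s, dist (f.vertexMap x) (f.vertexMap y) = dist x y := by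
    intro x hx y hy
    have hx' := mem_vertices_of_mem hs.1 hx
    have hy' := mem_vertices_of_mem hs.1 hy
    have := hf ⟨x, hx'⟩ ⟨y, hy'⟩ ⟨s, hs.1, hx, hy⟩
    rwa [← f.vertexMap_apply, ← f.vertexMap_apply] at this
  rw [f.exteriorAngle_image hs.1 hs.2, exteriorAngle, angleAt]
  congr 3
  refine Finset.sum_congr rfl fun x hx => Finset.sum_congr rfl fun y hy => ?_
  have hx := Finset.mem_of_mem_erase hx
  have hy := Finset.mem_of_mem_erase hy
  exact (angle_eq_of_dist_eq (hdist x hx v hs.2) (hdist y hy v hs.2) (hdist x hx y hy)).symm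

theorem tendsto_angle {x v y : EuclideanSpace ℝ (Fin d)} (hx : x ≠ v) (hy : y ≠ v)
    {f g h : ℕ → EuclideanSpace ℝ (Fin d)} (hf : Filter.Tendsto f Filter.atTop (nhds x))
    (hg : Filter.Tendsto g Filter.atTop (nhds v)) (hh : Filter.Tendsto h Filter.atTop (nhds y)) :
    Filter.Tendsto (fun n => EuclideanGeometry.angle (f n) (g n) (h n)) Filter.atTop
      (nhds (EuclideanGeometry.angle x v y)) := by
  have hc := EuclideanGeometry.continuousAt_angle (x := (x, v, y)) hx hy
  have hp := hf.prodMk_nhds (hg.prodMk_nhds hh)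
  have hcp := hc.tendsto.comp hp
  exact hcp

theorem tendsto_curvature {K : TwoComplex d} {J : ℕ → TwoComplex d} (f : ∀ n, K.CombEquiv (J n))
    (hf : ∀ v : K.vertices, Filter.Tendsto
      (fun n => ((f n).toEquiv v : EuclideanSpace ℝ (Fin d))) Filter.atTop (nhds v))
    (v : K.vertices) : Filter.Tendsto (fun n => (J n).curvature ((f n).toEquiv v)) Filter.atTop
      (nhds (K.curvature v)) := by
  simp_rw [CombEquiv.curvature_eq]
  refine tendsto_finsetSum _ fun s hs => ?_
  rw [Finset.mem_filter, mem_facesFinset] at hs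
  simp_rw [CombEquiv.exteriorAngle_image _ hs.1 hs.2]
  have hlim : ∀ x ∈ s, Filter.Tendsto (fun n => (f n).vertexMap x) Filter.atTop (nhds x) := by
    intro x hx
    refine (hf ⟨x, mem_vertices_of_mem hs.1 hx⟩).congr fun n => ?_
    rw [← CombEquiv.vertexMap_apply]
  refine tendsto_const_nhds.sub (Filter.Tendsto.div_const (Filter.Tendsto.div_const ?_ _) _)
  refine tendsto_finsetSum _ fun x hx => tendsto_finsetSum _ fun y hy => ?_
  -- The angle is continuous only where both arms are nonzero, which `erase` guarantees.
  rw [Finset.mem_erase] at hx hy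
  exact tendsto_angle hx.1 hy.1 (hlim x hx.2) (hlim v hs.2) (hlim y hy.2)

/-! ### Stars of simplices -/

/-- The star of the simplex with vertex set `A`. -/
def faceStar (K : TwoComplex d) (A : Finset (EuclideanSpace ℝ (Fin d))) : TwoComplex d where
  faces := {s | s.Nonempty ∧ ∃ t ∈ K.faces, A ⊆ t ∧ s ⊆ t}
  isRelLowerSet_faces := by
    rintro s ⟨hs, t, ht, hv, hst⟩
    exact ⟨hs, fun u hu hne => ⟨hne, t, ht, hv, hu.trans hst⟩⟩
  indep := by
    rintro s ⟨hs, t, ht, hv, hst⟩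
    exact K.indep (K.down_closed ht hst hs)
  inter_subset_convexHull := by
    rintro s s' ⟨hs, t, ht, hv, hst⟩ ⟨hs', t', ht', hv', hst'⟩
    exact K.inter_subset_convexHull (K.down_closed ht hst hs) (K.down_closed ht' hst' hs')
  finite_faces := K.finite_faces.subset fun s ⟨hs, t, ht, _, hst⟩ => K.down_closed ht hst hs
  card_le_three := fun s ⟨hs, t, ht, _, hst⟩ => K.card_le_three s (K.down_closed ht hst hs)

theorem mem_faceStar_vertices_iff {K : TwoComplex d} {A : Finset (EuclideanSpace ℝ (Fin d))}
    {x : EuclideanSpace ℝ (Fin d)} :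
    x ∈ (K.faceStar A).vertices ↔ insert x A ∈ K.faces := by
  constructor
  · rintro ⟨_, t, ht, hA, hx⟩
    exact K.down_closed ht (Finset.insert_subset (hx (Finset.mem_singleton_self x)) hA)
      (Finset.insert_nonempty _ _)
  · intro h
    exact ⟨Finset.singleton_nonempty x, _, h, Finset.subset_insert _ _, by simp⟩

theorem faceStar_empty (K : TwoComplex d) : K.faceStar ∅ = K := by
  refine ext_faces fun s => ⟨?_, fun hs => ?_⟩
  · rintro ⟨hs, t, ht, _, hst⟩
    exact K.down_closed ht hst hs
  · exact ⟨K.nonempty_of_mem_faces hs, s, hs, by simp, subset_rfl⟩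

/-- Stars of simplices are thus iterated stars of vertices; starting from `faceStar_empty`,
star-closedness keeps them in `T`. -/
theorem star_faceStar (K : TwoComplex d) (A : Finset (EuclideanSpace ℝ (Fin d)))
    (x : EuclideanSpace ℝ (Fin d)) : (K.faceStar A).star x = K.faceStar (insert x A) := by
  refine ext_faces fun s => ⟨?_, ?_⟩
  · rintro ⟨hs, t, ⟨_, u, hu, hA, htu⟩, hx, hst⟩
    exact ⟨hs, u, hu, Finset.insert_subset (htu hx) hA, hst.trans htu⟩
  · rintro ⟨hs, u, hu, hA, hsu⟩
    rw [Finset.insert_subset_iff] at hA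
    exact ⟨hs, u, ⟨⟨x, hA.1⟩, u, hu, hA.2, subset_rfl⟩, hA.1, hsu⟩

theorem isCone_faceStar {K : TwoComplex d} {A : Finset (EuclideanSpace ℝ (Fin d))}
    (hA : A ∈ K.faces) : (K.faceStar A).IsCone := by
  obtain ⟨v, hv⟩ := K.nonempty_of_mem_faces hA
  refine ⟨v, mem_faceStar_vertices_iff.2 (by rwa [Finset.insert_eq_of_mem hv]), ?_⟩
  rintro s ⟨_, t, ht, hAt, hst⟩
  exact ⟨t, ⟨⟨v, hAt hv⟩, t, ht, hAt, subset_rfl⟩, hAt hv, hst⟩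

theorem starsIsometric_of_star_eq {K L : TwoComplex d} {v : K.vertices} {w : L.vertices}
    (hvw : v.1 = w.1) (h : K.star v = L.star w) : StarsIsometric K v L w := by
  have hV : (K.star v).vertices = (L.star w).vertices := by rw [h]
  have hmap : ∀ s : Finset (K.star v).vertices,
      (s.map (Equiv.setCongr hV).toEmbedding).map (.subtype _) = s.map (.subtype _) := by
    intro s
    ext x
    simp [hV]
  refine ⟨⟨Equiv.setCongr hV, fun s => ?_⟩, fun x y _ => rfl, hvw⟩
  rw [hmap, show (L.star w).faces = (K.star v).faces by rw [h]]

theorem mem_of_faceStar {T : Set EuclideanTwoComplex} (hstar : StarClosed T) {K : TwoComplex d}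
    (hK : (⟨d, K⟩ : EuclideanTwoComplex) ∈ T) (A : Finset (EuclideanSpace ℝ (Fin d))) :
    A = ∅ ∨ A ∈ K.faces → (⟨d, K.faceStar A⟩ : EuclideanTwoComplex) ∈ T := by
  induction A using Finset.induction_on with
  | empty => intro _; rwa [faceStar_empty]
  | insert x A hx ih =>
    rintro (h | h)
    · simp at h
    · rw [← star_faceStar]
      refine hstar _ (ih ?_) x (mem_faceStar_vertices_iff.2 h)
      rcases A.eq_empty_or_nonempty with h0 | h0
      · exact .inl h0
      · exact .inr (K.down_closed h (Finset.subset_insert _ _) h0)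

end TwoComplex

/-! ### Uniqueness by counting in stars of simplices. -/

theorem VertexFunction.eq_eulerFunction {T : Set EuclideanTwoComplex} (hstar : StarClosed T)
    {φ : VertexFunction T} (hφ : φ.InvariantUnderStarIsometry) {Λ : ComplexFunction T}
    (hΛ : φ.SatisfiesDGB Λ) (hcone : ∀ K : T, K.1.2.IsCone → Λ K = 1) : Λ = eulerFunction T := by
  funext ⟨⟨d, K⟩, hK⟩
  -- Extending `φ` by `0` removes the membership proofs from its arguments; the default is never
  -- reached in the sums below.
  let ψ : TwoComplex d → EuclideanSpace ℝ (Fin d) → ℝ := fun L x =>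
    if h : (⟨d, L⟩ : EuclideanTwoComplex) ∈ T ∧ x ∈ L.vertices then φ ⟨⟨d, L⟩, h.1⟩ ⟨x, h.2⟩ else 0
  have hψ : ∀ (L : TwoComplex d) (hL : (⟨d, L⟩ : EuclideanTwoComplex) ∈ T),
      ∑ x ∈ L.verticesFinset, ψ L x = Λ ⟨⟨d, L⟩, hL⟩ := by
    intro L hL
    rw [← hΛ, ← L.sum_vertices]
    refine Finset.sum_congr rfl fun x _ => ?_
    exact dif_pos (show (⟨d, L⟩ : EuclideanTwoComplex) ∈ T ∧ x.1 ∈ L.vertices from ⟨hL, x.2⟩)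
  -- The two complexes have the same star at `x`, namely `faceStar (insert x A)`, so the identity is
  -- an isometry of stars.
  have hstep : ∀ A, A = ∅ ∨ A ∈ K.faces → ∀ x, insert x A ∈ K.faces →
      ψ (K.faceStar A) x = ψ (K.faceStar (insert x A)) x := by
    intro A hA x hx
    have h1 := TwoComplex.mem_of_faceStar hstar hK A hA
    have h2 := TwoComplex.mem_of_faceStar hstar hK (insert x A) (.inr hx)
    have h3 : x ∈ (K.faceStar A).vertices := TwoComplex.mem_faceStar_vertices_iff.2 hx
    have h4 : x ∈ (K.faceStar (insert x A)).vertices :=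
      TwoComplex.mem_faceStar_vertices_iff.2 (by simpa using hx)
    simp only [ψ]
    rw [dif_pos ⟨h1, h3⟩, dif_pos ⟨h2, h4⟩]
    refine hφ ⟨_, h1⟩ ⟨_, h2⟩ ⟨x, h3⟩ ⟨x, h4⟩ (TwoComplex.starsIsometric_of_star_eq rfl ?_)
    simp [TwoComplex.star_faceStar]
  let G : ℕ → ℝ := fun i => ∑ t ∈ K.facesFinset with t.card = i + 1, ∑ x ∈ t, ψ (K.faceStar t) x
  have hG0 : Λ ⟨⟨d, K⟩, hK⟩ = G 0 := by
    rw [← hψ]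
    refine Finset.sum_bij (fun x _ => {x}) ?_ ?_ ?_ ?_
      |>.trans (Finset.sum_congr rfl fun t _ => rfl)
    · intro x hx
      simpa [Geometry.SimplicialComplex.mem_vertices] using hx
    · simp
    · intro t ht
      simp only [Finset.mem_filter, TwoComplex.mem_facesFinset, zero_add] at ht
      obtain ⟨x, rfl⟩ := Finset.card_eq_one.1 ht.2
      exact ⟨x, by simpa [Geometry.SimplicialComplex.mem_vertices] using ht.1, rfl⟩
    · intro x hx
      have := hstep ∅ (.inl rfl) x
        (by simpa [Geometry.SimplicialComplex.mem_vertices] using hx)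
      simpa [TwoComplex.faceStar_empty] using this
  have hG : ∀ i, (K.numSimplices i : ℝ) = G i + G (i + 1) := by
    intro i
    -- The `1` is the value of `Λ` on the cone `faceStar s`; its vertices lie either in `s` or in
    -- the link of `s`.
    have h1 : ∀ s ∈ K.facesFinset.filter (fun s => s.card = i + 1), (1 : ℝ) =
        ∑ x ∈ s, ψ (K.faceStar s) x +
          ∑ x ∈ K.verticesFinset with x ∉ s ∧ insert x s ∈ K.faces,
            ψ (K.faceStar (insert x s)) x := by
      intro s hs
      rw [Finset.mem_filter, TwoComplex.mem_facesFinset] at hs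
      have hsT := TwoComplex.mem_of_faceStar hstar hK s (.inr hs.1)
      rw [← hcone ⟨_, hsT⟩ (TwoComplex.isCone_faceStar hs.1), ← hψ,
        ← Finset.sum_filter_add_sum_filter_not _ (fun x => x ∈ s)]
      congr 1
      · refine Finset.sum_congr ?_ fun _ _ => rfl
        ext x
        simp only [Finset.mem_filter, TwoComplex.mem_verticesFinset,
          TwoComplex.mem_faceStar_vertices_iff, and_iff_right_iff_imp]
        intro hx
        rw [Finset.insert_eq_of_mem hx]
        exact hs.1
      · refine Finset.sum_congr ?_ fun x hx => ?_
        · ext x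
          simp only [Finset.mem_filter, TwoComplex.mem_verticesFinset,
            TwoComplex.mem_faceStar_vertices_iff]
          exact ⟨fun h => ⟨TwoComplex.mem_vertices_of_mem h.1 (by simp), h.2, h.1⟩,
            fun h => ⟨h.2.2, h.2.1⟩⟩
        · simp only [Finset.mem_filter] at hx
          exact hstep s (.inr hs.1) x hx.2.2
    rw [TwoComplex.numSimplices_eq, Finset.cast_card, Finset.sum_congr rfl h1,
      Finset.sum_add_distrib]
    congr 1
    simp only [G]
    rw [Finset.sum_sigma', Finset.sum_sigma']
    -- A simplex with a link vertex is the same as a simplex one dimension higher with a marked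
    -- vertex.
    refine Finset.sum_bij' (fun p _ => ⟨insert p.2 p.1, p.2⟩) (fun p _ => ⟨p.1.erase p.2, p.2⟩)
      ?_ ?_ ?_ ?_ ?_
    · rintro ⟨s, x⟩ h
      simp only [Finset.mem_sigma, Finset.mem_filter, TwoComplex.mem_facesFinset] at h ⊢
      refine ⟨⟨h.2.2.2, ?_⟩, Finset.mem_insert_self _ _⟩
      rw [Finset.card_insert_of_notMem h.2.2.1, h.1.2]
    · rintro ⟨t, x⟩ h
      simp only [Finset.mem_sigma, Finset.mem_filter, TwoComplex.mem_facesFinset,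
        TwoComplex.mem_verticesFinset] at h ⊢
      have hc := Finset.card_erase_add_one h.2
      refine ⟨⟨K.down_closed h.1.1 (Finset.erase_subset _ _) ?_, by omega⟩,
        TwoComplex.mem_vertices_of_mem h.1.1 h.2, Finset.notMem_erase _ _, ?_⟩
      · rw [← Finset.card_pos]
        omega
      · rw [Finset.insert_erase h.2]
        exact h.1.1
    · rintro ⟨s, x⟩ h
      simp only [Finset.mem_sigma, Finset.mem_filter] at h
      simp [Finset.erase_insert h.2.2.1]
    · rintro ⟨t, x⟩ h
      simp only [Finset.mem_sigma, Finset.mem_filter] at h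
      simp [Finset.insert_erase h.2]
    · rintro ⟨s, x⟩ h
      rfl
  have hG3 : G 3 = 0 := by
    refine Finset.sum_eq_zero fun t ht => ?_
    rw [Finset.mem_filter, TwoComplex.mem_facesFinset] at ht
    have := K.card_le_three t ht.1
    omega
  have h0 := hG 0
  have h1 := hG 1
  have h2 := hG 2
  norm_num at h0 h1 h2
  rw [hG0]
  simp only [eulerFunction, TwoComplex.eulerChar]
  push_cast
  rw [h0, h1, h2, hG3]
  ring

/-! ### Affine functions on simplices -/

section Affine

variable {E : Type*} [AddCommGroup E] [Module ℝ E]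

theorem affineMap_eq_of_mem_convexHull (f : E →ᵃ[ℝ] ℝ) {S : Set E} {r : ℝ}
    (h : ∀ x ∈ S, f x = r) {x : E} (hx : x ∈ convexHull ℝ S) : f x = r :=
  convexHull_min (t := f ⁻¹' {r}) h ((convex_singleton r).affine_preimage f) hx

theorem affineMap_combination (f : E →ᵃ[ℝ] ℝ) {v : E} (hv : f v = 0) (p q : ℝ) (y z : E) :
    f (v + p • (y - v) + q • (z - v)) = p * f y + q * f z := by
  have h : ∀ x : E, f x = f.linear (x - v) := by
    intro x
    rw [← vsub_eq_sub, AffineMap.linearMap_vsub]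
    simp [hv]
  rw [h, h y, h z]
  have : v + p • (y - v) + q • (z - v) - v = p • (y - v) + q • (z - v) := by abel
  rw [this]
  simp

theorem affineMap_sum (f : E →ᵃ[ℝ] ℝ) (s : Finset E) {w : E → ℝ} (hw : ∑ i ∈ s, w i = 1) :
    f (∑ i ∈ s, w i • i) = ∑ i ∈ s, w i * f i := by
  have h : ∀ x : E, f x = f.linear x + f 0 := fun x => by
    simpa using f.map_vadd 0 x
  rw [h, map_sum]
  have h' : ∀ i ∈ s, w i * f i = f.linear (w i • i) + w i * f 0 := fun i _ => by
    rw [h i, map_smul, smul_eq_mul]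
    ring
  rw [Finset.sum_congr rfl h', Finset.sum_add_distrib, ← Finset.sum_mul, hw, one_mul]

theorem mem_convexHull_pair_iff {v a x : E} :
    x ∈ convexHull ℝ ({v, a} : Set E) ↔ ∃ p : ℝ, 0 ≤ p ∧ p ≤ 1 ∧ x = v + p • (a - v) := by
  rw [convexHull_pair, segment_eq_image']
  constructor
  · rintro ⟨p, hp, rfl⟩
    exact ⟨p, hp.1, hp.2, rfl⟩
  · rintro ⟨p, h0, h1, rfl⟩
    exact ⟨p, ⟨h0, h1⟩, rfl⟩

theorem mem_convexHull_triple_iff {v a b x : E} :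
    x ∈ convexHull ℝ ({v, a, b} : Set E) ↔
      ∃ p q : ℝ, 0 ≤ p ∧ 0 ≤ q ∧ p + q ≤ 1 ∧ x = v + p • (a - v) + q • (b - v) := by
  constructor
  · intro hx
    let C : Set E := {x | ∃ p q : ℝ, 0 ≤ p ∧ 0 ≤ q ∧ p + q ≤ 1 ∧
      x = v + p • (a - v) + q • (b - v)}
    have hC : Convex ℝ C := by
      rintro _ ⟨p, q, hp, hq, hpq, rfl⟩ _ ⟨p', q', hp', hq', hpq', rfl⟩ α β hα hβ hαβ
      refine ⟨α * p + β * p', α * q + β * q', by positivity, by positivity, by nlinarith, ?_⟩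
      obtain rfl : β = 1 - α := by linarith
      module
    refine convexHull_min (t := C) ?_ hC hx
    rintro y (rfl | rfl | rfl)
    · exact ⟨0, 0, by simp⟩
    · exact ⟨1, 0, by simp⟩
    · exact ⟨0, 1, by simp⟩
  · rintro ⟨p, q, hp, hq, hpq, rfl⟩
    have h := convex_convexHull ℝ ({v, a, b} : Set E)
    have hv : v ∈ convexHull ℝ ({v, a, b} : Set E) := subset_convexHull ℝ _ (by simp)
    have ha : a ∈ convexHull ℝ ({v, a, b} : Set E) := subset_convexHull ℝ _ (by simp)
    have hb : b ∈ convexHull ℝ ({v, a, b} : Set E) := subset_convexHull ℝ _ (by simp)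
    have := h.sum_mem (t := Finset.univ) (w := ![1 - p - q, p, q]) (z := ![v, a, b])
      (by intro i _; fin_cases i <;> simp <;> linarith)
      (by simp [Fin.sum_univ_three]; ring)
      (by intro i _; fin_cases i <;> simpa)
    convert! this using 1
    simp [Fin.sum_univ_three]
    module

/-- If an affine function is nonnegative on a simplex and vanishes at a point of it, then it
vanishes at each vertex that has positive weight at that point. -/
theorem affineMap_eq_zero_of_weight_pos (f : E →ᵃ[ℝ] ℝ) {s : Finset E} {w : E → ℝ}
    (hw0 : ∀ i ∈ s, 0 ≤ w i) (hw : ∑ i ∈ s, w i = 1) (hf : ∀ i ∈ s, 0 ≤ f i)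
    (h0 : f (∑ i ∈ s, w i • i) = 0) {i : E} (hi : i ∈ s) (hwi : 0 < w i) : f i = 0 := by
  rw [affineMap_sum f s hw, Finset.sum_eq_zero_iff_of_nonneg
    fun i hi => mul_nonneg (hw0 i hi) (hf i hi)] at h0
  rcases mul_eq_zero.1 (h0 i hi) with h | h
  · exact absurd h hwi.ne'
  · exact h

end Affine

/-- Affine functions that restrict to the barycentric coordinates with respect to `a` and `b` on
the triangle `v a b`. -/
structure TriangleCoords {E : Type*} [AddCommGroup E] [Module ℝ E] (v a b : E) where
  fst : E →ᵃ[ℝ] ℝ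
  snd : E →ᵃ[ℝ] ℝ
  fst_apex : fst v = 0
  fst_left : fst a = 1
  fst_right : fst b = 0
  snd_apex : snd v = 0
  snd_left : snd a = 0
  snd_right : snd b = 1

namespace TriangleCoords

variable {E : Type*} [AddCommGroup E] [Module ℝ E] {v a b : E}

/-- The coordinates with the two vertices other than the apex exchanged. -/
@[simps]
def swap (c : TriangleCoords v a b) : TriangleCoords v b a :=
  ⟨c.snd, c.fst, c.snd_apex, c.snd_right, c.snd_left, c.fst_apex, c.fst_right, c.fst_left⟩

/-- The determinant of `y - v` and `z - v`, as an affine function of `z`. -/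
def det (c : TriangleCoords v a b) (y : E) : E →ᵃ[ℝ] ℝ := c.fst y • c.snd - c.snd y • c.fst

theorem det_apply (c : TriangleCoords v a b) (y z : E) :
    c.det y z = c.fst y * c.snd z - c.snd y * c.fst z := by
  simp [det]

theorem det_apex (c : TriangleCoords v a b) (y : E) : c.det y v = 0 := by
  simp [det_apply, c.fst_apex, c.snd_apex]

theorem det_self (c : TriangleCoords v a b) (y : E) : c.det y y = 0 := by
  rw [det_apply]
  ring

theorem det_swap (c : TriangleCoords v a b) (y z : E) : c.swap.det y z = c.det z y := by
  simp only [det_apply, swap_fst, swap_snd]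
  ring

theorem eq_combination (c : TriangleCoords v a b) {x : E}
    (hx : x ∈ convexHull ℝ ({v, a, b} : Set E)) :
    x = v + c.fst x • (a - v) + c.snd x • (b - v) := by
  obtain ⟨p, q, -, -, -, rfl⟩ := mem_convexHull_triple_iff.1 hx
  rw [affineMap_combination _ c.fst_apex, affineMap_combination _ c.snd_apex, c.fst_left,
    c.fst_right, c.snd_left, c.snd_right]
  simp

theorem bounds (c : TriangleCoords v a b) {x : E}
    (hx : x ∈ convexHull ℝ ({v, a, b} : Set E)) :
    0 ≤ c.fst x ∧ 0 ≤ c.snd x ∧ c.fst x + c.snd x ≤ 1 := by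
  obtain ⟨p, q, hp, hq, hpq, rfl⟩ := mem_convexHull_triple_iff.1 hx
  rw [affineMap_combination _ c.fst_apex, affineMap_combination _ c.snd_apex, c.fst_left,
    c.fst_right, c.snd_left, c.snd_right]
  simp [hp, hq, hpq]

theorem mem_edge_of_fst_eq_zero (c : TriangleCoords v a b) {x : E}
    (hx : x ∈ convexHull ℝ ({v, a, b} : Set E)) (h : c.fst x = 0) :
    x ∈ convexHull ℝ ({v, b} : Set E) := by
  have h1 := c.bounds hx
  have h2 := c.eq_combination hx
  rw [h] at h1 h2
  exact mem_convexHull_pair_iff.2 ⟨c.snd x, h1.2.1, by linarith, by simpa using h2⟩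

theorem fst_add_snd_pos (c : TriangleCoords v a b) {x : E}
    (hx : x ∈ convexHull ℝ ({v, a, b} : Set E)) (hxv : x ≠ v) : 0 < c.fst x + c.snd x := by
  have h1 := c.bounds hx
  have h2 := c.eq_combination hx
  rcases (add_nonneg h1.1 h1.2.1).lt_or_eq with h | h
  · exact h
  · refine absurd ?_ hxv
    have h3 : c.fst x = 0 := by linarith
    have h4 : c.snd x = 0 := by linarith
    rw [h3, h4] at h2
    simpa using h2

end TriangleCoords

/-- Extending the vertices to an affine basis of the whole space makes the barycentric coordinate
globally defined, so no plane of the triangle has to be chosen. -/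
theorem exists_affine_coordinate {d : ℕ} {t : Finset (EuclideanSpace ℝ (Fin d))}
    (ht : AffineIndependent ℝ ((↑) : t → EuclideanSpace ℝ (Fin d)))
    {c : EuclideanSpace ℝ (Fin d)} (hc : c ∈ t) :
    ∃ f : EuclideanSpace ℝ (Fin d) →ᵃ[ℝ] ℝ, f c = 1 ∧ ∀ x ∈ t, x ≠ c → f x = 0 := by
  obtain ⟨u, htu, hu, htop⟩ := exists_subset_affineIndependent_affineSpan_eq_top
    (s := (t : Set (EuclideanSpace ℝ (Fin d)))) ht
  let b : AffineBasis u ℝ (EuclideanSpace ℝ (Fin d)) := ⟨Subtype.val, hu, by simpa using htop⟩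
  refine ⟨b.coord ⟨c, htu hc⟩, b.coord_apply_eq ⟨c, htu hc⟩, fun x hx hxc => ?_⟩
  exact b.coord_apply_ne (i := ⟨c, htu hc⟩) (j := ⟨x, htu hx⟩) (by simpa using hxc.symm)

theorem exists_triangleCoords {d : ℕ} {v a b : EuclideanSpace ℝ (Fin d)}
    (hva : v ≠ a) (hvb : v ≠ b) (hab : a ≠ b)
    (ht : AffineIndependent ℝ ((↑) : ({v, a, b} : Finset (EuclideanSpace ℝ (Fin d))) →
      EuclideanSpace ℝ (Fin d))) : Nonempty (TriangleCoords v a b) := by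
  obtain ⟨f, hf, hf'⟩ := exists_affine_coordinate ht (c := a) (by simp)
  obtain ⟨g, hg, hg'⟩ := exists_affine_coordinate ht (c := b) (by simp)
  exact ⟨⟨f, g, hf' v (by simp) hva, hf, hf' b (by simp) hab.symm, hg' v (by simp) hvb,
    hg' a (by simp) hab, hg⟩⟩

namespace TwoComplex

variable {d : ℕ} {J K : TwoComplex d} {v a b : EuclideanSpace ℝ (Fin d)}

/-! ### Edges of a complex along a common ray -/

/-- The endpoint of the shorter edge lies in the other edge, and a vertex of `J` lying in a simplex
of `J` is one of its vertices. -/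
theorem eq_of_sameRay {y z : EuclideanSpace ℝ (Fin d)} (hy : {v, y} ∈ J.faces)
    (hz : {v, z} ∈ J.faces) (hyv : y ≠ v) (hzv : z ≠ v) {k : ℝ} (hk : 0 < k)
    (h : y - v = k • (z - v)) : y = z := by
  have key : ∀ {y z : EuclideanSpace ℝ (Fin d)}, {v, y} ∈ J.faces → {v, z} ∈ J.faces → y ≠ v →
      ∀ {k : ℝ}, 0 < k → k ≤ 1 → y - v = k • (z - v) → y = z := by
    intro y z hy hz hyv k hk hk1 h
    have hmem : y ∈ convexHull ℝ (({v, z} : Finset (EuclideanSpace ℝ (Fin d))) : Set _) := by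
      rw [Finset.coe_pair, mem_convexHull_pair_iff]
      exact ⟨k, hk.le, hk1, by rw [← h]; abel⟩
    have := (Geometry.SimplicialComplex.vertex_mem_convexHull_iff
      (mem_vertices_of_mem hy (by simp)) hz).1 hmem
    simpa [hyv] using this
  rcases le_total k 1 with hk1 | hk1
  · exact key hy hz hyv hk hk1 h
  · refine (key hz hy hzv (inv_pos.2 hk) (inv_le_one_of_one_le₀ hk1) ?_).symm
    rw [h, smul_smul, inv_mul_cancel₀ hk.ne', one_smul]

theorem eq_of_mem_edge {y z : EuclideanSpace ℝ (Fin d)} (hy : {v, y} ∈ J.faces)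
    (hz : {v, z} ∈ J.faces) (hyv : y ≠ v) (hzv : z ≠ v)
    (hya : y ∈ convexHull ℝ ({v, a} : Set (EuclideanSpace ℝ (Fin d))))
    (hza : z ∈ convexHull ℝ ({v, a} : Set (EuclideanSpace ℝ (Fin d)))) : y = z := by
  obtain ⟨p, hp0, -, hp⟩ := mem_convexHull_pair_iff.1 hya
  obtain ⟨q, hq0, -, hq⟩ := mem_convexHull_pair_iff.1 hza
  have hp' : 0 < p := hp0.lt_of_ne fun h => hyv (by rw [hp, ← h]; simp)
  have hq' : 0 < q := hq0.lt_of_ne fun h => hzv (by rw [hq, ← h]; simp)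
  refine eq_of_sameRay hy hz hyv hzv (div_pos hp' hq') ?_
  have h1 : y - v = p • (a - v) := by rw [hp]; abel
  have h2 : z - v = q • (a - v) := by rw [hq]; abel
  rw [h1, h2, smul_smul, div_mul_cancel₀ _ hq'.ne']

/-- If a path starting at `x 0` stays in the space of `J`, then some simplex of `J` contains
`x 0` and, for arbitrarily small parameters, points of the path. -/
theorem exists_face_frequently {x : ℝ → EuclideanSpace ℝ (Fin d)} (hx : Continuous x)
    (h : ∀ᶠ δ in nhdsWithin 0 (Set.Ioi 0), x δ ∈ J.space) :
    ∃ s ∈ J.faces, (∃ᶠ δ in nhdsWithin 0 (Set.Ioi 0),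
      x δ ∈ convexHull ℝ (s : Set (EuclideanSpace ℝ (Fin d)))) ∧
        x 0 ∈ convexHull ℝ (s : Set (EuclideanSpace ℝ (Fin d))) := by
  have h1 : ∃ᶠ δ in nhdsWithin (0 : ℝ) (Set.Ioi 0), ∃ s ∈ J.faces,
      x δ ∈ convexHull ℝ (s : Set (EuclideanSpace ℝ (Fin d))) :=
    (h.mono fun δ hδ => Geometry.SimplicialComplex.mem_space_iff.1 hδ).frequently
  -- Pigeonhole: there are finitely many simplices, so one of them is met for arbitrarily small
  -- parameters; being closed, it also contains the limit `x 0`.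
  obtain ⟨s, hs, hsx⟩ := (J.finite_faces.frequently_exists).1 h1
  refine ⟨s, hs, hsx, ?_⟩
  exact (s.finite_toSet.isClosed_convexHull ℝ).mem_of_frequently_of_tendsto hsx
    (hx.continuousWithinAt (s := Set.Ioi 0) (x := 0))

/-- `x` lies in the hull of the common vertices of the edge and `t`; if one endpoint were missing
from `t`, then `x` would have to be the other one. -/
theorem pair_subset_of_mem_convexHull {t : Finset (EuclideanSpace ℝ (Fin d))}
    (ha : {v, a} ∈ K.faces) (ht : t ∈ K.faces) {x : EuclideanSpace ℝ (Fin d)}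
    (hxa : x ∈ convexHull ℝ ({v, a} : Set (EuclideanSpace ℝ (Fin d))))
    (hxt : x ∈ convexHull ℝ (t : Set (EuclideanSpace ℝ (Fin d)))) (hv : x ≠ v) (hne : x ≠ a) :
    {v, a} ⊆ t := by
  have h := K.inter_subset_convexHull ha ht ⟨by simpa using hxa, hxt⟩
  rw [Finset.insert_subset_iff, Finset.singleton_subset_iff]
  constructor
  · by_contra hvt
    have : ((({v, a} : Finset (EuclideanSpace ℝ (Fin d))) : Set (EuclideanSpace ℝ (Fin d))) ∩ t) ⊆
        {a} := by
      rintro z ⟨hz, hzt⟩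
      simp only [Finset.coe_pair] at hz
      rcases hz with rfl | rfl
      · exact absurd hzt hvt
      · rfl
    simpa [hne] using convexHull_mono this h
  · by_contra hat
    have : ((({v, a} : Finset (EuclideanSpace ℝ (Fin d))) : Set (EuclideanSpace ℝ (Fin d))) ∩ t) ⊆
        {v} := by
      rintro z ⟨hz, hzt⟩
      simp only [Finset.coe_pair] at hz
      rcases hz with rfl | rfl
      · rfl
      · exact absurd hzt hat
    simpa [hv] using convexHull_mono this h

/-- A subdivision of `K` has an edge that runs from `v` along a given edge of `K` at `v`. -/
theorem IsSubdivision.exists_edge (h : J.IsSubdivision K) (hav : a ≠ v) (ha : {v, a} ∈ K.faces) :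
    ∃ y, y ≠ v ∧ {v, y} ∈ J.faces ∧
      y ∈ convexHull ℝ ({v, a} : Set (EuclideanSpace ℝ (Fin d))) := by
  have hvJ : v ∈ J.vertices := h.vertices_subset (mem_vertices_of_mem ha (by simp))
  have hlt : ∀ᶠ δ in nhdsWithin (0 : ℝ) (Set.Ioi 0), 0 < δ ∧ δ < 1 :=
    Filter.eventually_of_mem (Ioo_mem_nhdsGT one_pos) fun δ hδ => hδ
  have hedge : ∀ δ : ℝ, 0 < δ ∧ δ < 1 →
      v + δ • (a - v) ∈ convexHull ℝ ({v, a} : Set (EuclideanSpace ℝ (Fin d))) :=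
    fun δ hδ => mem_convexHull_pair_iff.2 ⟨δ, hδ.1.le, hδ.2.le, rfl⟩
  -- A simplex of `J` that carries the start of the edge contains `v`; since `x ≠ v`, it also has
  -- another vertex with positive weight at `x`.
  obtain ⟨s, hs, hfreq, h0⟩ := exists_face_frequently (J := J) (x := fun δ => v + δ • (a - v))
    (by fun_prop) (hlt.mono fun δ hδ => by
      rw [h.1]
      exact Geometry.SimplicialComplex.convexHull_subset_space ha (by simpa using hedge δ hδ))
  have hvs : v ∈ s := (Geometry.SimplicialComplex.vertex_mem_convexHull_iff hvJ hs).1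
    (by simpa using h0)
  obtain ⟨δ, hxs, hδ⟩ := (hfreq.and_eventually hlt).exists
  set x := v + δ • (a - v) with hx
  have hav' : a - v ≠ 0 := sub_ne_zero.2 hav
  have hxv : x ≠ v := by
    intro hh
    have : δ • (a - v) = 0 := by simpa [hx] using hh
    exact (smul_ne_zero hδ.1.ne' hav') this
  have hxa : x ≠ a := by
    intro hh
    have : (1 - δ) • (a - v) = 0 := by
      have h1 : a - v = δ • (a - v) := by
        nth_rewrite 1 [← hh]
        rw [hx]
        abel
      rw [sub_smul, one_smul, ← h1, sub_self]
    exact (smul_ne_zero (by linarith [hδ.2]) hav') this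
  obtain ⟨t, ht, hst⟩ := h.2 s hs
  have hvat := pair_subset_of_mem_convexHull ha ht (hedge δ hδ) (hst hxs) hxv hxa
  obtain ⟨w, hw0, hw1, hwx⟩ := Finset.mem_convexHull'.1 hxs
  obtain ⟨y, hys, hyv, hwy⟩ : ∃ y ∈ s, y ≠ v ∧ 0 < w y := by
    by_contra! hcon
    have hz : ∀ y ∈ s, y ≠ v → w y = 0 := fun y hy hyv => le_antisymm (hcon y hy hyv) (hw0 y hy)
    have h1 : ∑ i ∈ s, w i = w v :=
      Finset.sum_eq_single_of_mem v hvs fun i hi hiv => hz i hi hiv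
    have h2 : ∑ i ∈ s, w i • i = w v • v :=
      Finset.sum_eq_single_of_mem v hvs fun i hi hiv => by rw [hz i hi hiv, zero_smul]
    rw [h1] at hw1
    rw [h2, hw1, one_smul] at hwx
    exact hxv hwx.symm
  refine ⟨y, hyv, J.down_closed hs (by simp [Finset.insert_subset_iff, hvs, hys]) (by simp), ?_⟩
  have hyt : y ∈ convexHull ℝ (t : Set (EuclideanSpace ℝ (Fin d))) :=
    hst (subset_convexHull ℝ _ hys)
  -- Otherwise `t` is a triangle with a third vertex `c`. The coordinate of `c` is nonnegative on
  -- `s` and zero at `x`, hence zero at the vertex `y`.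
  by_cases htva : t = {v, a}
  · simpa [htva] using hyt
  · obtain ⟨c, hct, hc⟩ := Finset.exists_of_ssubset (hvat.ssubset_of_ne (Ne.symm htva))
    simp only [Finset.mem_insert, Finset.mem_singleton, not_or] at hc
    have hcard : ({c, v, a} : Finset (EuclideanSpace ℝ (Fin d))).card = 3 :=
      Finset.card_eq_three.2 ⟨c, v, a, hc.1, hc.2, hav.symm, rfl⟩
    have hteq : ({v, c, a} : Finset (EuclideanSpace ℝ (Fin d))) = t := by
      rw [Finset.insert_comm]
      refine Finset.eq_of_subset_of_card_le (Finset.insert_subset hct hvat) ?_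
      rw [hcard]
      exact K.card_le_three t ht
    subst hteq
    obtain ⟨C⟩ := exists_triangleCoords (Ne.symm hc.1) hav.symm hc.2 (K.indep ht)
    simp only [Finset.coe_insert, Finset.coe_singleton] at hst hyt
    refine C.mem_edge_of_fst_eq_zero hyt ?_
    refine affineMap_eq_zero_of_weight_pos C.fst hw0 hw1
      (fun i hi => (C.bounds (hst (subset_convexHull ℝ _ hi))).1) ?_ hys hwy
    rw [hwx]
    refine affineMap_eq_of_mem_convexHull C.fst ?_ (hedge δ hδ)
    rintro z (rfl | rfl)
    · exact C.fst_apex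
    · exact C.fst_right

/-! ### The fan that a subdivision induces at a vertex of a triangle -/

/-- Push the midpoint of the edge `v y` slightly towards `b`. The simplex of `J` entered there
contains this edge and has its third vertex on the `b` side, which is what the sign of `det`
records. -/
theorem IsSubdivision.exists_next (h : J.IsSubdivision K) (ht : {v, a, b} ∈ K.faces)
    (hcard : ({v, a, b} : Finset (EuclideanSpace ℝ (Fin d))).card = 3) (c : TriangleCoords v a b)
    {y : EuclideanSpace ℝ (Fin d)} (hy : {v, y} ∈ J.faces) (hyv : y ≠ v)
    (hyt : y ∈ convexHull ℝ ({v, a, b} : Set (EuclideanSpace ℝ (Fin d)))) (hpos : 0 < c.fst y) :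
    ∃ z, {v, y, z} ∈ J.faces ∧
      z ∈ convexHull ℝ ({v, a, b} : Set (EuclideanSpace ℝ (Fin d))) ∧ 0 < c.det y z := by
  obtain ⟨hy1, hy2, hy3⟩ := c.bounds hyt
  let x : ℝ → EuclideanSpace ℝ (Fin d) := fun δ => v + (1 / 2 : ℝ) • (y - v) + δ • (b - v)
  have hfst : ∀ δ, c.fst (x δ) = c.fst y / 2 := by
    intro δ
    rw [affineMap_combination _ c.fst_apex, c.fst_right]
    ring
  have hsnd : ∀ δ, c.snd (x δ) = c.snd y / 2 + δ := by
    intro δ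
    rw [affineMap_combination _ c.snd_apex, c.snd_right]
    ring
  have hlt : ∀ᶠ δ in nhdsWithin (0 : ℝ) (Set.Ioi 0), 0 < δ ∧ δ < 1 / 2 :=
    Filter.eventually_of_mem (Ioo_mem_nhdsGT one_half_pos) fun δ hδ => hδ
  have hxt : ∀ δ : ℝ, 0 < δ ∧ δ < 1 / 2 →
      x δ ∈ convexHull ℝ ({v, a, b} : Set (EuclideanSpace ℝ (Fin d))) := by
    intro δ hδ
    refine mem_convexHull_triple_iff.2 ⟨c.fst y / 2, c.snd y / 2 + δ, by linarith,
      by linarith [hδ.1], by linarith [hδ.2], ?_⟩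
    have := c.eq_combination hyt
    have hyv' : y - v = c.fst y • (a - v) + c.snd y • (b - v) := by
      nth_rewrite 1 [this]
      abel
    simp only [x, hyv']
    module
  obtain ⟨s, hs, hfreq, h0⟩ := exists_face_frequently (J := J) (x := x)
    (by fun_prop) (hlt.mono fun δ hδ => by
      rw [h.1]
      exact Geometry.SimplicialComplex.convexHull_subset_space ht (by simpa using hxt δ hδ))
  have hvys : {v, y} ⊆ s := by
    refine pair_subset_of_mem_convexHull hy hs (x := x 0) ?_ h0 ?_ ?_
    · exact mem_convexHull_pair_iff.2 ⟨1 / 2, by norm_num, by norm_num, by simp [x]⟩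
    · intro hh
      have := hfst 0
      rw [hh, c.fst_apex] at this
      linarith
    · intro hh
      have := hfst 0
      rw [hh] at this
      linarith
  obtain ⟨δ, hxs, hδ⟩ := (hfreq.and_eventually hlt).exists
  have hdet : 0 < c.det y (x δ) := by
    have : c.det y (x δ) = δ * c.fst y := by
      rw [c.det_apply, hfst, hsnd]
      ring
    rw [this]
    exact mul_pos hδ.1 hpos
  have hne : ({v, y} : Finset (EuclideanSpace ℝ (Fin d))) ≠ s := by
    rintro rfl
    refine hdet.ne' (affineMap_eq_of_mem_convexHull (c.det y) ?_ hxs)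
    intro z hz
    simp only [Finset.coe_pair] at hz
    rcases hz with rfl | rfl
    · exact c.det_apex y
    · exact c.det_self _
  obtain ⟨z, hzs, hz⟩ := Finset.exists_of_ssubset (hvys.ssubset_of_ne hne)
  simp only [Finset.mem_insert, Finset.mem_singleton, not_or] at hz
  have hseq : ({v, y, z} : Finset (EuclideanSpace ℝ (Fin d))) = s := by
    refine Finset.eq_of_subset_of_card_le ?_ ?_
    · intro u hu
      simp only [Finset.mem_insert, Finset.mem_singleton] at hu
      rcases hu with rfl | rfl | rfl
      · exact hvys (by simp)
      · exact hvys (by simp)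
      · exact hzs
    · rw [Finset.card_eq_three.2 ⟨v, y, z, hyv.symm, Ne.symm hz.1, Ne.symm hz.2, rfl⟩]
      exact J.card_le_three s hs
  refine ⟨z, hseq ▸ hs, ?_, ?_⟩
  · obtain ⟨t', ht', hst'⟩ := h.2 s hs
    have hint := K.inter_subset_convexHull ht ht' ⟨by simpa using hxt δ hδ, hst' hxs⟩
    -- `x δ` is interior to the triangle, so the simplex `t'` of `K` containing it has all three
    -- vertices: if one were missing, the corresponding coordinate would be constant on the common
    -- face. For `v` the test function is `fst + snd`, which is `1` on the opposite side.
    have hf : ∀ (f : EuclideanSpace ℝ (Fin d) →ᵃ[ℝ] ℝ) (u : EuclideanSpace ℝ (Fin d)) (r : ℝ),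
        f (x δ) ≠ r → (∀ p ∈ ({v, a, b} : Finset (EuclideanSpace ℝ (Fin d))), p ≠ u → f p = r) →
        u ∈ t' := by
      intro f u r hfx hfr
      by_contra hu
      refine hfx (affineMap_eq_of_mem_convexHull f ?_ hint)
      rintro p ⟨hp, hpt⟩
      exact hfr p hp fun hpu => hu (hpu ▸ hpt)
    have hat : a ∈ t' := by
      refine hf c.fst a 0 (by rw [hfst]; linarith) ?_
      intro p hp hpa
      simp only [Finset.mem_insert, Finset.mem_singleton] at hp
      rcases hp with rfl | rfl | rfl
      · exact c.fst_apex
      · exact absurd rfl hpa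
      · exact c.fst_right
    have hbt : b ∈ t' := by
      refine hf c.snd b 0 (by rw [hsnd]; linarith [hδ.1]) ?_
      intro p hp hpa
      simp only [Finset.mem_insert, Finset.mem_singleton] at hp
      rcases hp with rfl | rfl | rfl
      · exact c.snd_apex
      · exact c.snd_left
      · exact absurd rfl hpa
    have hvt : v ∈ t' := by
      refine hf (c.fst + c.snd) v 1 ?_ ?_
      · simp only [AffineMap.coe_add, Pi.add_apply, hfst, hsnd]
        linarith [hδ.2]
      intro p hp hpa
      simp only [Finset.mem_insert, Finset.mem_singleton] at hp
      rcases hp with rfl | rfl | rfl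
      · exact absurd rfl hpa
      · simp [c.fst_left, c.snd_left]
      · simp [c.fst_right, c.snd_right]
    have hteq : ({v, a, b} : Finset (EuclideanSpace ℝ (Fin d))) = t' := by
      refine Finset.eq_of_subset_of_card_le ?_ (hcard ▸ K.card_le_three t' ht')
      intro u hu
      simp only [Finset.mem_insert, Finset.mem_singleton] at hu
      rcases hu with rfl | rfl | rfl <;> assumption
    have := hst' (subset_convexHull ℝ _ hzs)
    rw [← hteq] at this
    simpa using this
  -- On the triangle `v y z` the function `det y` is a nonnegative multiple of its value at `z`.
  · rw [← hseq] at hxs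
    simp only [Finset.coe_insert, Finset.coe_singleton] at hxs
    obtain ⟨p, q, hp, hq, -, hpq⟩ := mem_convexHull_triple_iff.1 hxs
    rw [hpq, affineMap_combination _ (c.det_apex y), c.det_self] at hdet
    simp only [mul_zero, zero_add] at hdet
    exact pos_of_mul_pos_right hdet hq

/-- Two triangles on the same side of the edge `v y` share a point off that edge, while distinct
triangles of `J` with this common edge meet only in it. -/
theorem next_unique (c : TriangleCoords v a b) {y z z' : EuclideanSpace ℝ (Fin d)}
    (hz : {v, y, z} ∈ J.faces) (hz' : {v, y, z'} ∈ J.faces)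
    (hyt : y ∈ convexHull ℝ ({v, a, b} : Set (EuclideanSpace ℝ (Fin d))))
    (hzt : z ∈ convexHull ℝ ({v, a, b} : Set (EuclideanSpace ℝ (Fin d))))
    (hzt' : z' ∈ convexHull ℝ ({v, a, b} : Set (EuclideanSpace ℝ (Fin d))))
    (hdet : 0 < c.det y z) (hdet' : 0 < c.det y z') : z = z' := by
  by_contra hne
  have hy1 : y - v = c.fst y • (a - v) + c.snd y • (b - v) :=
    (sub_eq_of_eq_add' ((c.eq_combination hyt).trans (add_assoc _ _ _)))
  have hz1 : z - v = c.fst z • (a - v) + c.snd z • (b - v) :=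
    (sub_eq_of_eq_add' ((c.eq_combination hzt).trans (add_assoc _ _ _)))
  have hz1' : z' - v = c.fst z' • (a - v) + c.snd z' • (b - v) :=
    (sub_eq_of_eq_add' ((c.eq_combination hzt').trans (add_assoc _ _ _)))
  -- Cramer's rule in the coordinates of the triangle.
  obtain ⟨α, β, hβ, hαβ⟩ : ∃ α β : ℝ, 0 < β ∧ z' - v = α • (y - v) + β • (z - v) := by
    refine ⟨c.det z' z / c.det y z, c.det y z' / c.det y z, div_pos hdet' hdet, ?_⟩
    have hD := hdet.ne'
    have h1 : c.fst z' = c.det z' z / c.det y z * c.fst y + c.det y z' / c.det y z * c.fst z := by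
      field_simp
      simp only [c.det_apply]
      ring
    have h2 : c.snd z' = c.det z' z / c.det y z * c.snd y + c.det y z' / c.det y z * c.snd z := by
      field_simp
      simp only [c.det_apply]
      ring
    rw [hz1', hy1, hz1, h1, h2]
    generalize c.det z' z / c.det y z = α
    generalize c.det y z' / c.det y z = β
    module
  -- `α` may be negative. Adding `M • (y - v)` with `M = |α|` makes both coefficients nonnegative,
  -- and the factor `k` scales the point into both triangles.
  set M := |α| with hM
  have hM0 : 0 ≤ M := abs_nonneg α
  have hMα : -α ≤ M := neg_le_abs α
  have hMα' : α ≤ M := le_abs_self α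
  set k := (1 + 2 * M + β)⁻¹ with hk
  have hk0 : 0 < k := by positivity
  have hk1 : k * (1 + 2 * M + β) = 1 := inv_mul_cancel₀ (by positivity)
  set x := v + (k * M) • (y - v) + k • (z' - v) with hx
  have hxz' : x ∈ convexHull ℝ ({v, y, z'} : Set (EuclideanSpace ℝ (Fin d))) :=
    mem_convexHull_triple_iff.2 ⟨k * M, k, by positivity, hk0.le, by nlinarith, rfl⟩
  have hxz : x ∈ convexHull ℝ ({v, y, z} : Set (EuclideanSpace ℝ (Fin d))) := by
    refine mem_convexHull_triple_iff.2 ⟨k * (M + α), k * β, ?_, by positivity, by nlinarith, ?_⟩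
    · exact mul_nonneg hk0.le (by linarith)
    · rw [hx, hαβ]
      module
  have hxdet : 0 < c.det y x := by
    rw [hx, affineMap_combination _ (c.det_apex y), c.det_self]
    have := mul_pos hk0 hdet'
    linarith
  have hmem := J.inter_subset_convexHull hz hz' ⟨by simpa using hxz, by simpa using hxz'⟩
  refine hxdet.ne' (affineMap_eq_of_mem_convexHull (c.det y) ?_ hmem)
  rintro u ⟨hu, hu'⟩
  simp only [Finset.coe_insert, Finset.coe_singleton] at hu hu'
  rcases hu with rfl | rfl | rfl
  · exact c.det_apex y
  · exact c.det_self _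
  · rcases hu' with rfl | rfl | rfl
    · exact c.det_apex y
    · exact c.det_self _
    · exact absurd rfl hne

/-- The vertices other than `v` of the edges of `J` that contain `v` and lie in the simplex
spanned by `t`. -/
def fanVertices (J : TwoComplex d) (v : EuclideanSpace ℝ (Fin d))
    (t : Finset (EuclideanSpace ℝ (Fin d))) : Finset (EuclideanSpace ℝ (Fin d)) :=
  J.verticesFinset.filter fun y => y ≠ v ∧ {v, y} ∈ J.faces ∧
    y ∈ convexHull ℝ (t : Set (EuclideanSpace ℝ (Fin d)))

theorem mem_fanVertices {t : Finset (EuclideanSpace ℝ (Fin d))} {y : EuclideanSpace ℝ (Fin d)} :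
    y ∈ J.fanVertices v t ↔ y ≠ v ∧ {v, y} ∈ J.faces ∧
      y ∈ convexHull ℝ (t : Set (EuclideanSpace ℝ (Fin d))) := by
  simp only [fanVertices, Finset.mem_filter, mem_verticesFinset, and_iff_right_iff_imp]
  exact fun h => mem_vertices_of_mem h.2.1 (by simp)

/-- The positively oriented pairs of fan vertices that span a triangle of `J` with `v`. -/
def fanPairs (J : TwoComplex d) (c : TriangleCoords v a b) :
    Finset (EuclideanSpace ℝ (Fin d) × EuclideanSpace ℝ (Fin d)) :=
  (J.fanVertices v {v, a, b} ×ˢ J.fanVertices v {v, a, b}).filter fun p =>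
    {v, p.1, p.2} ∈ J.faces ∧ 0 < c.det p.1 p.2

theorem mem_fanPairs {c : TriangleCoords v a b}
    {p : EuclideanSpace ℝ (Fin d) × EuclideanSpace ℝ (Fin d)} :
    p ∈ J.fanPairs c ↔ p.1 ∈ J.fanVertices v {v, a, b} ∧ p.2 ∈ J.fanVertices v {v, a, b} ∧
      {v, p.1, p.2} ∈ J.faces ∧ 0 < c.det p.1 p.2 := by
  simp [fanPairs, and_assoc]

theorem coe_triple (v a b : EuclideanSpace ℝ (Fin d)) :
    (({v, a, b} : Finset (EuclideanSpace ℝ (Fin d))) : Set (EuclideanSpace ℝ (Fin d))) =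
      {v, a, b} := by
  simp

/-- Every fan vertex except the last one, `yb` on the side `v b`, is the first entry of exactly one
pair, by `exists_next` and `next_unique`. The weight `F` allows both counting and telescoping. -/
theorem IsSubdivision.sum_fanPairs_fst (h : J.IsSubdivision K) (ht : {v, a, b} ∈ K.faces)
    (hcard : ({v, a, b} : Finset (EuclideanSpace ℝ (Fin d))).card = 3) (c : TriangleCoords v a b)
    {yb : EuclideanSpace ℝ (Fin d)} (hyb : yb ≠ v) (hybJ : {v, yb} ∈ J.faces)
    (hyb' : yb ∈ convexHull ℝ ({v, b} : Set (EuclideanSpace ℝ (Fin d))))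
    (F : EuclideanSpace ℝ (Fin d) → ℝ) :
    ∑ p ∈ J.fanPairs c, F p.1 = ∑ y ∈ (J.fanVertices v {v, a, b}).erase yb, F y := by
  have hybfst : c.fst yb = 0 := by
    refine affineMap_eq_of_mem_convexHull c.fst ?_ hyb'
    rintro z (rfl | rfl)
    · exact c.fst_apex
    · exact c.fst_right
  refine Finset.sum_bij (fun p _ => p.1) ?_ ?_ ?_ ?_
  · intro p hp
    obtain ⟨hp1, hp2, -, hdet⟩ := mem_fanPairs.1 hp
    refine Finset.mem_erase.2 ⟨fun hh => ?_, hp1⟩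
    rw [mem_fanVertices, coe_triple] at hp1 hp2
    have h1 := c.bounds hp1.2.2
    have h2 := c.bounds hp2.2.2
    rw [c.det_apply, hh, hybfst, zero_mul] at hdet
    rw [hh] at h1
    have := mul_nonneg h1.2.1 h2.1
    linarith
  · rintro ⟨y, z⟩ hp ⟨y', z'⟩ hp' hyy
    obtain ⟨hp1, hp2, hp3, hp4⟩ := mem_fanPairs.1 hp
    obtain ⟨hp1', hp2', hp3', hp4'⟩ := mem_fanPairs.1 hp'
    dsimp only at hyy
    subst hyy
    rw [mem_fanVertices, coe_triple] at hp1 hp2 hp2'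
    exact Prod.ext rfl (next_unique c hp3 hp3' hp1.2.2 hp2.2.2 hp2'.2.2 hp4 hp4')
  · intro y hy
    rw [Finset.mem_erase, mem_fanVertices, coe_triple] at hy
    obtain ⟨hne, hyv, hyJ, hyt⟩ := hy
    have hpos : 0 < c.fst y := by
      refine (c.bounds hyt).1.lt_of_ne fun h0 => hne ?_
      exact eq_of_mem_edge hyJ hybJ hyv hyb (c.mem_edge_of_fst_eq_zero hyt h0.symm) hyb'
    obtain ⟨z, hz, hzt, hdet⟩ := h.exists_next ht hcard c hyJ hyv hyt hpos
    refine ⟨(y, z), mem_fanPairs.2 ⟨?_, ?_, hz, hdet⟩, rfl⟩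
    · rw [mem_fanVertices, coe_triple]
      exact ⟨hyv, hyJ, hyt⟩
    · rw [mem_fanVertices, coe_triple]
      refine ⟨?_, J.down_closed hz ?_ (by simp), hzt⟩
      · rintro rfl
        exact hdet.ne' (c.det_apex y)
      · simp [Finset.insert_subset_iff]
  · intro _ _
    rfl

/-- Exchanging `a` and `b` reverses orientation, so the statement on first entries also yields the
one on second entries. -/
theorem sum_fanPairs_swap (c : TriangleCoords v a b) (F : EuclideanSpace ℝ (Fin d) → ℝ) :
    ∑ p ∈ J.fanPairs c.swap, F p.1 = ∑ p ∈ J.fanPairs c, F p.2 := by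
  have hmem : ∀ p, p ∈ J.fanPairs c.swap ↔ p.swap ∈ J.fanPairs c := by
    intro p
    rw [mem_fanPairs, mem_fanPairs, c.det_swap, Finset.pair_comm b a, Finset.pair_comm p.1 p.2]
    simp only [Prod.fst_swap, Prod.snd_swap]
    tauto
  refine Finset.sum_bij' (fun p _ => p.swap) (fun p _ => p.swap) ?_ ?_ ?_ ?_ ?_
  · exact fun p hp => (hmem p).1 hp
  · exact fun p hp => (hmem p.swap).2 (by simpa using hp)
  all_goals simp

/-- The ray to `y` lies between those to `a` and `z`: `y - v` is a nonnegative combination of `a -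
v` and `z - v`, with coefficients from Cramer's rule. -/
theorem angle_add_of_det_pos (c : TriangleCoords v a b) {y z : EuclideanSpace ℝ (Fin d)}
    (hyv : y ≠ v) (hyt : y ∈ convexHull ℝ ({v, a, b} : Set (EuclideanSpace ℝ (Fin d))))
    (hzt : z ∈ convexHull ℝ ({v, a, b} : Set (EuclideanSpace ℝ (Fin d))))
    (hdet : 0 < c.det y z) :
    EuclideanGeometry.angle a v z =
      EuclideanGeometry.angle a v y + EuclideanGeometry.angle y v z := by
  have hy1 : y - v = c.fst y • (a - v) + c.snd y • (b - v) :=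
    (sub_eq_of_eq_add' ((c.eq_combination hyt).trans (add_assoc _ _ _)))
  have hz1 : z - v = c.fst z • (a - v) + c.snd z • (b - v) :=
    (sub_eq_of_eq_add' ((c.eq_combination hzt).trans (add_assoc _ _ _)))
  have hyb := c.bounds hyt
  have hzb := c.bounds hzt
  have hzpos : 0 < c.snd z := by
    refine hzb.2.1.lt_of_ne fun h0 => ?_
    rw [c.det_apply, ← h0] at hdet
    have := mul_nonneg hyb.2.1 hzb.1
    linarith
  refine InnerProductGeometry.angle_eq_angle_add_add_angle_add_of_mem_span
    (vsub_ne_zero.2 hyv) ?_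
  rw [Submodule.mem_span_pair]
  refine ⟨⟨c.det y z / c.snd z, (div_pos hdet hzpos).le⟩,
    ⟨c.snd y / c.snd z, div_nonneg hyb.2.1 hzb.2.1⟩, ?_⟩
  change (c.det y z / c.snd z) • (a - v) + (c.snd y / c.snd z) • (z - v) = y - v
  rw [hy1, hz1, c.det_apply]
  match_scalars <;> field_simp <;> ring

theorem angle_eq_of_mem_edge {x y : EuclideanSpace ℝ (Fin d)} (hyv : y ≠ v)
    (hy : y ∈ convexHull ℝ ({v, b} : Set (EuclideanSpace ℝ (Fin d)))) :
    EuclideanGeometry.angle x v y = EuclideanGeometry.angle x v b := by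
  obtain ⟨p, hp0, -, hp⟩ := mem_convexHull_pair_iff.1 hy
  have hp' : 0 < p := hp0.lt_of_ne fun h => hyv (by rw [hp, ← h]; simp)
  have h1 : y - v = p • (b - v) := by rw [hp]; abel
  rw [EuclideanGeometry.angle, EuclideanGeometry.angle, vsub_eq_sub, vsub_eq_sub, vsub_eq_sub, h1,
    InnerProductGeometry.angle_smul_right_of_pos _ _ hp']

/-- The triangles into which a subdivision cuts an angle of a triangle: one less than the edges,
with angles that add up. -/
theorem IsSubdivision.fan (h : J.IsSubdivision K) (ht : {v, a, b} ∈ K.faces)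
    (hva : v ≠ a) (hvb : v ≠ b) (hab : a ≠ b) (c : TriangleCoords v a b) :
    ((J.fanPairs c).card : ℝ) = (J.fanVertices v {v, a, b}).card - 1 ∧
      ∑ p ∈ J.fanPairs c, EuclideanGeometry.angle p.1 v p.2 = EuclideanGeometry.angle a v b := by
  have hcard : ({v, a, b} : Finset (EuclideanSpace ℝ (Fin d))).card = 3 :=
    Finset.card_eq_three.2 ⟨v, a, b, hva, hvb, hab, rfl⟩
  obtain ⟨ya, hya, hyaJ, hya'⟩ := h.exists_edge hva.symm
    (K.down_closed ht (t := {v, a}) (by simp [Finset.insert_subset_iff]) (by simp))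
  obtain ⟨yb, hyb, hybJ, hyb'⟩ := h.exists_edge hvb.symm
    (K.down_closed ht (t := {v, b}) (by simp [Finset.insert_subset_iff]) (by simp))
  have hyaP : ya ∈ J.fanVertices v {v, a, b} := by
    rw [mem_fanVertices, coe_triple]
    exact ⟨hya, hyaJ, convexHull_mono (by grind) hya'⟩
  have hybP : yb ∈ J.fanVertices v {v, a, b} := by
    rw [mem_fanVertices, coe_triple]
    exact ⟨hyb, hybJ, convexHull_mono (by grind) hyb'⟩
  have hfst := h.sum_fanPairs_fst ht hcard c hyb hybJ hyb'
  have hsnd : ∀ F : EuclideanSpace ℝ (Fin d) → ℝ, ∑ p ∈ J.fanPairs c, F p.2 =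
      ∑ y ∈ (J.fanVertices v {v, a, b}).erase ya, F y := by
    intro F
    rw [← sum_fanPairs_swap, Finset.pair_comm a b]
    exact h.sum_fanPairs_fst (by rwa [Finset.pair_comm]) (by rwa [Finset.pair_comm]) c.swap hya
      hyaJ hya' F
  constructor
  · have := hfst fun _ => 1
    simp only [Finset.sum_const, nsmul_eq_mul, mul_one] at this
    rw [this, Finset.cast_card_erase_of_mem hybP]
  -- Telescoping: second entries omit only `ya`, first entries only `yb`, so what remains is the
  -- angle from `a` to `yb`, minus the zero angle from `a` to `ya`.
  · have hang : ∀ p ∈ J.fanPairs c, EuclideanGeometry.angle p.1 v p.2 =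
        EuclideanGeometry.angle a v p.2 - EuclideanGeometry.angle a v p.1 := by
      intro p hp
      obtain ⟨hp1, hp2, -, hdet⟩ := mem_fanPairs.1 hp
      rw [mem_fanVertices, coe_triple] at hp1 hp2
      rw [angle_add_of_det_pos c hp1.1 hp1.2.2 hp2.2.2 hdet]
      ring
    rw [Finset.sum_congr rfl hang, Finset.sum_sub_distrib,
      hfst fun y => EuclideanGeometry.angle a v y, hsnd fun y => EuclideanGeometry.angle a v y,
      Finset.sum_erase_eq_sub hyaP, Finset.sum_erase_eq_sub hybP, angle_eq_of_mem_edge hya hya',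
      angle_eq_of_mem_edge hyb hyb', EuclideanGeometry.angle_self_of_ne hva.symm]
    ring

end TwoComplex

/-! ### Invariance of the curvature under subdivision. -/

namespace TwoComplex

variable {d : ℕ} {J K : TwoComplex d} {v a b : EuclideanSpace ℝ (Fin d)}

/-- The contribution to the curvature of `J` at `v` of the simplices that lie in the simplex
spanned by `t`. -/
def curvatureIn (J : TwoComplex d) (v : EuclideanSpace ℝ (Fin d))
    (t : Finset (EuclideanSpace ℝ (Fin d))) : ℝ :=
  ∑ s ∈ J.facesFinset.filter (fun s : Finset (EuclideanSpace ℝ (Fin d)) => v ∈ s ∧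
    convexHull ℝ (s : Set (EuclideanSpace ℝ (Fin d))) ⊆ convexHull ℝ (t : Set _)),
      exteriorAngle v s

/-- The triangles of `J` at `v` that lie in the simplex spanned by `t`. -/
def trianglesIn (J : TwoComplex d) (v : EuclideanSpace ℝ (Fin d))
    (t : Finset (EuclideanSpace ℝ (Fin d))) : Finset (Finset (EuclideanSpace ℝ (Fin d))) :=
  J.facesFinset.filter fun s : Finset (EuclideanSpace ℝ (Fin d)) => s.card = 3 ∧ v ∈ s ∧
    convexHull ℝ (s : Set (EuclideanSpace ℝ (Fin d))) ⊆ convexHull ℝ (t : Set _)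

theorem convexHull_subset_convexHull_iff {s t : Finset (EuclideanSpace ℝ (Fin d))} :
    convexHull ℝ (s : Set (EuclideanSpace ℝ (Fin d))) ⊆ convexHull ℝ (t : Set _) ↔
      ∀ x ∈ s, x ∈ convexHull ℝ (t : Set (EuclideanSpace ℝ (Fin d))) :=
  ⟨fun h _ hx => h (subset_convexHull ℝ _ hx), fun h => convexHull_min h (convex_convexHull ℝ _)⟩

theorem exists_eq_triple {s : Finset (EuclideanSpace ℝ (Fin d))} (hs : s.card = 3) (hv : v ∈ s) :
    ∃ y z, y ≠ v ∧ z ≠ v ∧ y ≠ z ∧ s = {v, y, z} := by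
  have h2 : (s.erase v).card = 2 := by
    rw [Finset.card_erase_of_mem hv, hs]
  obtain ⟨y, z, hyz, hyz'⟩ := Finset.card_eq_two.1 h2
  have hy : y ∈ s.erase v := by simp [hyz']
  have hz : z ∈ s.erase v := by simp [hyz']
  exact ⟨y, z, Finset.ne_of_mem_erase hy, Finset.ne_of_mem_erase hz, hyz, by
    rw [← hyz', Finset.insert_erase hv]⟩

theorem exists_eq_pair {s : Finset (EuclideanSpace ℝ (Fin d))} (hs : s.card = 2) (hv : v ∈ s) :
    ∃ y, y ≠ v ∧ s = {v, y} := by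
  have h1 : (s.erase v).card = 1 := by
    rw [Finset.card_erase_of_mem hv, hs]
  obtain ⟨y, hy⟩ := Finset.card_eq_one.1 h1
  have hys : y ∈ s.erase v := by simp [hy]
  exact ⟨y, Finset.ne_of_mem_erase hys, by rw [← hy, Finset.insert_erase hv]⟩

theorem mem_fanVertices_of_mem {s t : Finset (EuclideanSpace ℝ (Fin d))} (hs : s ∈ J.faces)
    (hv : v ∈ s)
    (hst : convexHull ℝ (s : Set (EuclideanSpace ℝ (Fin d))) ⊆ convexHull ℝ (t : Set _))
    {y : EuclideanSpace ℝ (Fin d)} (hy : y ∈ s) (hyv : y ≠ v) : y ∈ J.fanVertices v t :=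
  mem_fanVertices.2 ⟨hyv, J.down_closed hs (by simp [Finset.insert_subset_iff, hv, hy]) (by simp),
    hst (subset_convexHull ℝ _ hy)⟩

/-- Edges at `v` inside `t` correspond to fan vertices, each contributing `-1/2`; the vertex itself
contributes `1`. -/
theorem curvatureIn_eq {t : Finset (EuclideanSpace ℝ (Fin d))} (hvJ : v ∈ J.vertices)
    (hvt : v ∈ t) :
    J.curvatureIn v t = 1 - (J.fanVertices v t).card / 2 +
      ∑ s ∈ J.trianglesIn v t, exteriorAngle v s := by
  have hvt' : v ∈ convexHull ℝ (t : Set (EuclideanSpace ℝ (Fin d))) := subset_convexHull ℝ _ hvt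
  have hsplit : (J.facesFinset.filter fun s : Finset (EuclideanSpace ℝ (Fin d)) => v ∈ s ∧
      convexHull ℝ (s : Set (EuclideanSpace ℝ (Fin d))) ⊆ convexHull ℝ (t : Set _)) =
      ({{v}} ∪ (J.fanVertices v t).image fun y => {v, y}) ∪ J.trianglesIn v t := by
    ext s
    simp only [Finset.mem_filter, mem_facesFinset, Finset.mem_union, Finset.mem_singleton,
      Finset.mem_image, trianglesIn]
    constructor
    · rintro ⟨hs, hv, hst⟩
      rcases card_eq_one_or_two_or_three hs with h | h | h
      · obtain ⟨x, rfl⟩ := Finset.card_eq_one.1 h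
        rw [Finset.mem_singleton] at hv
        exact .inl (.inl (by rw [hv]))
      · obtain ⟨y, hy, rfl⟩ := exists_eq_pair h hv
        exact .inl (.inr ⟨y, mem_fanVertices_of_mem hs hv hst (by simp) hy, rfl⟩)
      · exact .inr ⟨hs, h, hv, hst⟩
    · rintro ((rfl | ⟨y, hy, rfl⟩) | ⟨hs, -, hv, hst⟩)
      · exact ⟨hvJ, by simp, by simpa using hvt'⟩
      · rw [mem_fanVertices] at hy
        refine ⟨hy.2.1, by simp, convexHull_subset_convexHull_iff.2 ?_⟩
        simp [hvt', hy.2.2]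
      · exact ⟨hs, hv, hst⟩
  have hpair : ∀ y ∈ J.fanVertices v t,
      ({v, y} : Finset (EuclideanSpace ℝ (Fin d))).card = 2 := by
    intro y hy
    exact Finset.card_pair (mem_fanVertices.1 hy).1.symm
  rw [curvatureIn, hsplit, Finset.sum_union, Finset.sum_union, Finset.sum_singleton,
    Finset.sum_image, exteriorAngle_singleton]
  · congr 1
    rw [Finset.sum_congr rfl fun y hy => exteriorAngle_pair (mem_fanVertices.1 hy).1]
    simp only [Finset.sum_const, nsmul_eq_mul]
    ring
  · intro y hy z hz hyz
    have hy' := (mem_fanVertices.1 hy).1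
    have : y ∈ ({v, z} : Finset (EuclideanSpace ℝ (Fin d))) := by
      dsimp only at hyz
      rw [← hyz]
      simp
    simpa [hy'] using this
  · rw [Finset.disjoint_singleton_left]
    intro h
    obtain ⟨y, hy, hyv⟩ := Finset.mem_image.1 h
    have := hpair y hy
    rw [hyv] at this
    simp at this
  · rw [Finset.disjoint_left]
    intro s hs hs'
    simp only [trianglesIn, Finset.mem_filter] at hs'
    rw [Finset.mem_union, Finset.mem_singleton, Finset.mem_image] at hs
    rcases hs with rfl | ⟨y, hy, rfl⟩
    · simp at hs'
    · have := hpair y hy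
      omega

theorem IsSubdivision.curvatureIn_singleton (h : J.IsSubdivision K) (hv : {v} ∈ K.faces) :
    J.curvatureIn v {v} = 1 := by
  have hP : J.fanVertices v {v} = ∅ := by
    refine Finset.eq_empty_of_forall_notMem fun y hy => ?_
    rw [mem_fanVertices] at hy
    exact hy.1 (by simpa using hy.2.2)
  have hT : J.trianglesIn v {v} = ∅ := by
    refine Finset.eq_empty_of_forall_notMem fun s hs => ?_
    simp only [trianglesIn, Finset.mem_filter, mem_facesFinset] at hs
    obtain ⟨y, z, hy, -, -, rfl⟩ := exists_eq_triple hs.2.1 hs.2.2.1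
    have := mem_fanVertices_of_mem hs.1 hs.2.2.1 hs.2.2.2 (y := y) (by simp) hy
    simp [hP] at this
  rw [curvatureIn_eq (h.vertices_subset hv) (by simp), hP, hT]
  simp

theorem IsSubdivision.curvatureIn_pair (h : J.IsSubdivision K) (hav : a ≠ v)
    (ha : {v, a} ∈ K.faces) : J.curvatureIn v {v, a} = 1 / 2 := by
  obtain ⟨y, hy, hyJ, hya⟩ := h.exists_edge hav ha
  have hP : J.fanVertices v {v, a} = {y} := by
    ext z
    rw [mem_fanVertices, Finset.mem_singleton, Finset.coe_pair]
    refine ⟨fun hz => eq_of_mem_edge hz.2.1 hyJ hz.1 hy hz.2.2 hya, ?_⟩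
    rintro rfl
    exact ⟨hy, hyJ, hya⟩
  have hT : J.trianglesIn v {v, a} = ∅ := by
    refine Finset.eq_empty_of_forall_notMem fun s hs => ?_
    simp only [trianglesIn, Finset.mem_filter, mem_facesFinset] at hs
    obtain ⟨p, q, hp, hq, hpq, rfl⟩ := exists_eq_triple hs.2.1 hs.2.2.1
    have h1 := mem_fanVertices_of_mem hs.1 hs.2.2.1 hs.2.2.2 (y := p) (by simp) hp
    have h2 := mem_fanVertices_of_mem hs.1 hs.2.2.1 hs.2.2.2 (y := q) (by simp) hq
    rw [hP, Finset.mem_singleton] at h1 h2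
    exact hpq (h1.trans h2.symm)
  rw [curvatureIn_eq (h.vertices_subset (mem_vertices_of_mem ha (by simp))) (by simp), hP, hT]
  norm_num

/-- Coordinates of fan vertices are nonnegative with positive sum, so a vanishing determinant puts
both vertices on one ray from `v`; the scaling factor is the ratio of the sums. -/
theorem det_ne_zero (c : TriangleCoords v a b) {y z : EuclideanSpace ℝ (Fin d)}
    (hy : y ∈ J.fanVertices v {v, a, b}) (hz : z ∈ J.fanVertices v {v, a, b}) (hyz : y ≠ z) :
    c.det y z ≠ 0 := by
  intro h0
  rw [mem_fanVertices, coe_triple] at hy hz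
  have hy0 := c.fst_add_snd_pos hy.2.2 hy.1
  have hz0 := c.fst_add_snd_pos hz.2.2 hz.1
  refine hyz (eq_of_sameRay hy.2.1 hz.2.1 hy.1 hz.1 (div_pos hy0 hz0) ?_)
  have hy1 : y - v = c.fst y • (a - v) + c.snd y • (b - v) :=
    (sub_eq_of_eq_add' ((c.eq_combination hy.2.2).trans (add_assoc _ _ _)))
  have hz1 : z - v = c.fst z • (a - v) + c.snd z • (b - v) :=
    (sub_eq_of_eq_add' ((c.eq_combination hz.2.2).trans (add_assoc _ _ _)))
  rw [c.det_apply] at h0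
  have h1 : c.fst y = (c.fst y + c.snd y) / (c.fst z + c.snd z) * c.fst z := by
    field_simp
    linarith
  have h2 : c.snd y = (c.fst y + c.snd y) / (c.fst z + c.snd z) * c.snd z := by
    field_simp
    linarith
  rw [hy1, hz1, smul_add, smul_smul, smul_smul, ← h1, ← h2]

/-- Exactly one of the two orderings of the vertices other than `v` is positively oriented. -/
theorem sum_trianglesIn (c : TriangleCoords v a b) (F : Finset (EuclideanSpace ℝ (Fin d)) → ℝ) :
    ∑ s ∈ J.trianglesIn v {v, a, b}, F s = ∑ p ∈ J.fanPairs c, F {v, p.1, p.2} := by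
  have hneg : ∀ y z, c.det z y = -c.det y z := by
    intro y z
    rw [c.det_apply, c.det_apply]
    ring
  symm
  refine Finset.sum_bij (fun p _ => {v, p.1, p.2}) ?_ ?_ ?_ ?_
  · rintro ⟨y, z⟩ hp
    obtain ⟨hp1, hp2, hp3, hdet⟩ := mem_fanPairs.1 hp
    rw [mem_fanVertices] at hp1 hp2
    have hyz : y ≠ z := by
      rintro rfl
      exact hdet.ne' (c.det_self _)
    simp only [trianglesIn, Finset.mem_filter, mem_facesFinset]
    refine ⟨hp3, Finset.card_eq_three.2 ⟨v, y, z, hp1.1.symm, hp2.1.symm, hyz, rfl⟩, by simp,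
      convexHull_subset_convexHull_iff.2 fun x hx => ?_⟩
    simp only [Finset.mem_insert, Finset.mem_singleton] at hx
    rcases hx with rfl | rfl | rfl
    · exact subset_convexHull ℝ _ (by simp)
    · exact hp1.2.2
    · exact hp2.2.2
  · rintro ⟨y, z⟩ hp ⟨y', z'⟩ hp' heq
    obtain ⟨hp1, hp2, -, hdet⟩ := mem_fanPairs.1 hp
    obtain ⟨hp1', hp2', -, hdet'⟩ := mem_fanPairs.1 hp'
    dsimp only at hp1 hp2 hdet hp1' hp2' hdet' heq
    have hy := (mem_fanVertices.1 hp1).1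
    have hz := (mem_fanVertices.1 hp2).1
    have hyz : y ≠ z := by
      rintro rfl
      exact hdet.ne' (c.det_self _)
    have hymem : y ∈ ({v, y', z'} : Finset (EuclideanSpace ℝ (Fin d))) := by
      rw [← heq]; simp
    have hzmem : z ∈ ({v, y', z'} : Finset (EuclideanSpace ℝ (Fin d))) := by
      rw [← heq]; simp
    simp only [Finset.mem_insert, Finset.mem_singleton, hy, hz, false_or] at hymem hzmem
    rcases hymem with rfl | rfl <;> rcases hzmem with rfl | rfl
    · exact absurd rfl hyz
    · rfl
    · rw [hneg] at hdet'
      linarith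
    · exact absurd rfl hyz
  · intro s hs
    simp only [trianglesIn, Finset.mem_filter, mem_facesFinset] at hs
    obtain ⟨y, z, hy, hz, hyz, rfl⟩ := exists_eq_triple hs.2.1 hs.2.2.1
    have h1 := mem_fanVertices_of_mem hs.1 hs.2.2.1 hs.2.2.2 (y := y) (by simp) hy
    have h2 := mem_fanVertices_of_mem hs.1 hs.2.2.1 hs.2.2.2 (y := z) (by simp) hz
    rcases (det_ne_zero c h1 h2 hyz).lt_or_gt with h | h
    · refine ⟨(z, y), mem_fanPairs.2 ⟨h2, h1, ?_, ?_⟩, ?_⟩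
      · dsimp only
        rw [Finset.pair_comm]
        exact hs.1
      · dsimp only
        rw [hneg]
        linarith
      · dsimp only
        rw [Finset.pair_comm]
    · exact ⟨(y, z), mem_fanPairs.2 ⟨h1, h2, hs.1, h⟩, rfl⟩
  · intro _ _
    rfl

/-- With `n` fan vertices and `n - 1` triangles, the contributions `1 - n/2 + (n-1)/2` leave `1/2`,
and the angles add up. -/
theorem IsSubdivision.curvatureIn_triple (h : J.IsSubdivision K) (ht : {v, a, b} ∈ K.faces)
    (hva : v ≠ a) (hvb : v ≠ b) (hab : a ≠ b) :
    J.curvatureIn v {v, a, b} = 1 / 2 - EuclideanGeometry.angle a v b / (2 * Real.pi) := by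
  obtain ⟨c⟩ := exists_triangleCoords hva hvb hab (K.indep ht)
  obtain ⟨h1, h2⟩ := h.fan ht hva hvb hab c
  have h3 : ∀ p ∈ J.fanPairs c, exteriorAngle v {v, p.1, p.2} =
      1 / 2 - EuclideanGeometry.angle p.1 v p.2 / (2 * Real.pi) := by
    intro p hp
    obtain ⟨hp1, hp2, -, hdet⟩ := mem_fanPairs.1 hp
    refine exteriorAngle_triple (mem_fanVertices.1 hp1).1 (mem_fanVertices.1 hp2).1 fun hh => ?_
    rw [hh, c.det_self] at hdet
    exact lt_irrefl _ hdet
  rw [curvatureIn_eq (h.vertices_subset (mem_vertices_of_mem ht (by simp))) (by simp),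
    sum_trianglesIn c, Finset.sum_congr rfl h3, Finset.sum_sub_distrib, Finset.sum_const, nsmul_eq_mul, h1,
    ← Finset.sum_div, h2]
  ring

theorem isSubdivision_refl (K : TwoComplex d) : K.IsSubdivision K :=
  ⟨rfl, fun s hs => ⟨s, hs, subset_rfl⟩⟩

/-- The computed values depend on `t` and `v` alone, and `K` is a subdivision of itself. -/
theorem IsSubdivision.curvatureIn_eq_curvatureIn (h : J.IsSubdivision K)
    {t : Finset (EuclideanSpace ℝ (Fin d))} (ht : t ∈ K.faces) (hv : v ∈ t) :
    J.curvatureIn v t = K.curvatureIn v t := by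
  have hK := K.isSubdivision_refl
  rcases card_eq_one_or_two_or_three ht with hc | hc | hc
  · obtain ⟨x, rfl⟩ := Finset.card_eq_one.1 hc
    rw [Finset.mem_singleton] at hv
    subst hv
    rw [h.curvatureIn_singleton ht, hK.curvatureIn_singleton ht]
  · obtain ⟨y, hy, rfl⟩ := exists_eq_pair hc hv
    rw [h.curvatureIn_pair hy ht, hK.curvatureIn_pair hy ht]
  · obtain ⟨y, z, hy, hz, hyz, rfl⟩ := exists_eq_triple hc hv
    rw [h.curvatureIn_triple ht hy.symm hz.symm hyz, hK.curvatureIn_triple ht hy.symm hz.symm hyz]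

/-- The smallest simplex of `K` that contains a given simplex of a subdivision. -/
theorem IsSubdivision.exists_carrier (h : J.IsSubdivision K)
    {s : Finset (EuclideanSpace ℝ (Fin d))} (hs : s ∈ J.faces) :
    ∃ t ∈ K.faces, ∀ t' ∈ K.faces,
      (convexHull ℝ (s : Set (EuclideanSpace ℝ (Fin d))) ⊆ convexHull ℝ (t' : Set _) ↔ t ⊆ t') := by
  obtain ⟨t₀, ht₀, hst₀⟩ := h.2 s hs
  -- A simplex of least cardinality works: its intersection with any other simplex of `K` containing
  -- `s` still contains `s`, so it cannot be smaller.
  obtain ⟨t, ht, hmin⟩ := Finset.exists_min_image (K.facesFinset.filter fun t : Finset (EuclideanSpace ℝ (Fin d)) =>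
    convexHull ℝ (s : Set (EuclideanSpace ℝ (Fin d))) ⊆ convexHull ℝ (t : Set _)) Finset.card
    ⟨t₀, by simpa using ⟨ht₀, hst₀⟩⟩
  simp only [Finset.mem_filter, mem_facesFinset] at ht hmin
  refine ⟨t, ht.1, fun t' ht' => ⟨fun hst' => ?_, fun htt' => ht.2.trans (convexHull_mono ?_)⟩⟩
  · have hint : convexHull ℝ (s : Set (EuclideanSpace ℝ (Fin d))) ⊆
        convexHull ℝ ((t ∩ t' : Finset (EuclideanSpace ℝ (Fin d))) : Set _) := by
      rw [Finset.coe_inter]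
      exact (Set.subset_inter ht.2 hst').trans (K.inter_subset_convexHull ht.1 ht')
    have hne : (t ∩ t').Nonempty := by
      obtain ⟨x, hx⟩ := J.nonempty_of_mem_faces hs
      have := hint (subset_convexHull ℝ _ hx)
      exact_mod_cast convexHull_nonempty_iff.1 ⟨x, this⟩
    have := hmin (t ∩ t') ⟨K.down_closed ht.1 Finset.inter_subset_left hne, hint⟩
    rw [← Finset.inter_eq_left]
    exact Finset.eq_of_subset_of_card_le Finset.inter_subset_left this
  · exact_mod_cast htt'

theorem curvatureIn_self_complex (K : TwoComplex d) (v : EuclideanSpace ℝ (Fin d))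
    {t : Finset (EuclideanSpace ℝ (Fin d))} (ht : t ∈ K.faces) :
    K.curvatureIn v t = ∑ s ∈ K.facesFinset with v ∈ s ∧ s ⊆ t, exteriorAngle v s := by
  rw [curvatureIn]
  congr 1
  refine Finset.filter_congr fun s hs => ?_
  rw [Geometry.SimplicialComplex.face_subset_face_iff (mem_facesFinset.1 hs) ht]

/-- The simplices of `J` at `v` are grouped by the smallest simplex of `K` containing them. Each
group contributes as much as that simplex itself. -/
theorem IsSubdivision.curvature_eq (h : J.IsSubdivision K) (hvK : v ∈ K.vertices) :
    J.curvature v = K.curvature v := by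
  have hvJ := h.vertices_subset hvK
  choose! κ hκ hκ' using fun s (hs : s ∈ J.faces) => h.exists_carrier hs
  have hvκ : ∀ s ∈ J.faces, v ∈ s → v ∈ κ s := fun s hs hvs =>
    (Geometry.SimplicialComplex.vertex_mem_convexHull_iff hvK (hκ s hs)).1
      (((hκ' s hs _ (hκ s hs)).2 subset_rfl) (subset_convexHull ℝ _ hvs))
  -- `curvatureIn` compares contributions of closed simplices; strong induction subtracts those of
  -- the proper faces, leaving the fibre over `t`.
  have hfib : ∀ t, t ∈ K.faces → v ∈ t →
      ∑ s ∈ J.facesFinset.filter (fun s => v ∈ s) with κ s = t, exteriorAngle v s =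
        exteriorAngle v t := by
    intro t
    induction t using Finset.strongInduction with
    | H t ih =>
      intro ht hvt
      have h1 := h.curvatureIn_eq_curvatureIn ht hvt
      have h2 : J.curvatureIn v t = ∑ t' ∈ K.facesFinset with v ∈ t' ∧ t' ⊆ t,
          ∑ s ∈ J.facesFinset.filter (fun s => v ∈ s) with κ s = t', exteriorAngle v s := by
        rw [curvatureIn, ← Finset.sum_fiberwise_of_maps_to (g := κ)
          (t := K.facesFinset.filter fun t' => v ∈ t' ∧ t' ⊆ t)]
        · refine Finset.sum_congr rfl fun t' ht' => Finset.sum_congr ?_ fun _ _ => rfl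
          simp only [Finset.mem_filter, mem_facesFinset] at ht'
          ext s
          simp only [Finset.mem_filter, mem_facesFinset]
          constructor
          · rintro ⟨⟨hs, hvs, -⟩, hst⟩
            exact ⟨⟨hs, hvs⟩, hst⟩
          · rintro ⟨⟨hs, hvs⟩, hst⟩
            exact ⟨⟨hs, hvs, (hκ' s hs t ht).2 (hst ▸ ht'.2.2)⟩, hst⟩
        · intro s hs
          simp only [Finset.mem_filter, mem_facesFinset] at hs ⊢
          exact ⟨hκ s hs.1, hvκ s hs.1 hs.2.1, (hκ' s hs.1 t ht).1 hs.2.2⟩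
      have hmem : t ∈ K.facesFinset.filter fun t' => v ∈ t' ∧ t' ⊆ t := by
        simp [ht, hvt]
      rw [curvatureIn_self_complex K v ht, h2, ← Finset.add_sum_erase _ _ hmem,
        ← Finset.add_sum_erase _ _ hmem] at h1
      have h3 : ∀ t' ∈ (K.facesFinset.filter fun t' => v ∈ t' ∧ t' ⊆ t).erase t,
          ∑ s ∈ J.facesFinset.filter (fun s => v ∈ s) with κ s = t', exteriorAngle v s =
            exteriorAngle v t' := by
        intro t' ht'
        simp only [Finset.mem_erase, Finset.mem_filter, mem_facesFinset] at ht'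
        exact ih t' (ht'.2.2.2.ssubset_of_ne ht'.1) ht'.2.1 ht'.2.2.1
      rw [Finset.sum_congr rfl h3] at h1
      exact add_right_cancel h1
  rw [curvature, curvature, ← Finset.sum_fiberwise_of_maps_to (g := κ)
    (t := K.facesFinset.filter fun t => v ∈ t)]
  · refine Finset.sum_congr rfl fun t ht => ?_
    simp only [Finset.mem_filter, mem_facesFinset] at ht
    exact hfib t ht.1 ht.2
  · intro s hs
    simp only [Finset.mem_filter, mem_facesFinset] at hs ⊢
    exact ⟨hκ s hs.1, hvκ s hs.1 hs.2⟩

end TwoComplex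

/-! ### Assembling existence and uniqueness. -/

theorem geometricallyLocallyDetermined_eulerFunction (T : Set EuclideanTwoComplex) :
    GeometricallyLocallyDetermined (eulerFunction T) :=
  ⟨fun K v => K.1.2.curvature v, fun _ _ _ _ h => h.curvature_eq,
    fun _ _ _ _ _ h v => (h.curvature_eq v.2).symm,
    fun _ _ _ _ _ f hf v => TwoComplex.tendsto_curvature f hf v,
    fun K => K.1.2.sum_curvature⟩

end

theorem corollary2p11 (T : Set EuclideanTwoComplex) (hstar : StarClosed T)
    (hfan : ∀ K : TwoComplex 2, K.IsPlanarFan → (⟨2, K⟩ : EuclideanTwoComplex) ∈ T) :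
    (GeometricallyLocallyDetermined (eulerFunction T) ∧
      ∀ K : T, K.1.2.IsCone → eulerFunction T K = 1) ∧
    ∀ Λ : ComplexFunction T, GeometricallyLocallyDetermined Λ →
      (∀ K : T, K.1.2.IsCone → Λ K = 1) → Λ = eulerFunction T := by
  refine ⟨⟨geometricallyLocallyDetermined_eulerFunction T, fun K hK => hK.eulerChar_eq_one⟩, ?_⟩
  rintro Λ ⟨φ, hiso, -, -, hdgb⟩ hcone
  exact φ.eq_eulerFunction hstar hiso hdgb hcone
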